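/- **Setting.** Place finitely many qubits on each site of $\mathbb{Z}$, and let $\mathcal{P}$ be the group of finitely supported Pauli operators (with phases $i^c$). Let $\mathcal{L}\subseteq\mathcal{P}$ be a subgroup and $\mathcal{S}\subseteq\mathcal{L}$ a normal subgroup. A homomorphism $U:\mathcal{L}/\mathcal{S}\to\mathcal{L}'/\mathcal{S}'$ (the primed groups possibly living on another such chain) *preserves locality* if for some $r$ and every $P\in\mathcal{L}$ the class $U[P]$ has a representative supported on the $r$-neighbourhood of $\mathrm{supp}(P)$. A *locality-preserving isomorphism* is an isomorphism such that it and its inverse preserve locality. An *MQCA* on $\mathcal{L}/\mathcal{S}$ is a locality-preserving isomorphism $\mathcal{L}/\mathcal{S}\to\mathcal{L}/\mathcal{S}$. For $R\subseteq\mathbb{Z}$ let $\mathcal{L}^{/\mathcal{S}}_R$ be the group of classes in $\mathcal{L}/\mathcal{S}$ with a representative supported on $R$. Put $$\mathcal{L}^{/\mathcal{S}}_{+\infty}=\bigcap_k\mathcal{L}^{/\mathcal{S}}_{(k,\infty)},\quad \mathcal{L}^{/\mathcal{S}}_{-\infty}=\bigcap_k\mathcal{L}^{/\mathcal{S}}_{(-\infty,k)},\quad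 \mathcal{F}=(\mathcal{L}/\mathcal{S})/(\mathcal{L}^{/\mathcal{S}}_{-\infty}\mathcal{L}^{/\mathcal{S}}_{+\infty}),$$ an $\mathbb{F}_2$-vector space, and let $\mathcal{F}_{<a}$ be the image of $\mathcal{L}^{/\mathcal{S}}_{(-\infty,a)}\mathcal{L}^{/\mathcal{S}}_{+\infty}$ in $\mathcal{F}$. An MQCA $\alpha$ induces a linear map $\bar\alpha:\mathcal{F}\to\mathcal{F}$. For $a\le b$, a subspace $\mathcal{F}_{<a}\subseteq\mathcal{F}_\circ\subseteq\mathcal{F}_{<b}$ and a projection $\nu$ of $\mathcal{F}$ onto $\mathcal{F}_\circ$, let $\phi=\nu\bar\alpha|_{\mathcal{F}_\circ}:\mathcal{F}_\circ\to\mathcal{F}_\circ$ and $$\mathrm{Ind}(\alpha)=\tfrac12\big(\dim\ker\phi-\dim\mathrm{coker}\,\phi\big).$$ **Proposition.** The index is well defined: for all choices of $a,b,\mathcal{F}_\circ,\nu$ the map $\phi$ has finite-dimensional kernel and cokernel, and $\mathrm{Ind}(\alpha)$ does not depend on the choices. Moreover: 1. Let $\alpha,\beta$ be MQCA on $\mathcal{L}_1/\mathcal{S}_1$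 and $\mathcal{L}_2/\mathcal{S}_2$ (on possibly different chains). Whenever $\alpha\otimes\beta:[P\otimes Q]\mapsto[P'\otimes Q']$, where $\alpha[P]=[P']$ and $\beta[Q]=[Q']$, is an MQCA on $(\mathcal{L}_1\otimes\mathcal{L}_2)/(\mathcal{S}_1\otimes\mathcal{S}_2)$ (a group of operators on the double-layer chain), $\mathrm{Ind}(\alpha\otimes\beta)=\mathrm{Ind}(\alpha)+\mathrm{Ind}(\beta)$. A unique such MQCA $\alpha\otimes\beta$ exists if and only if $\alpha$ and $\beta$ agree on scalars, that is, for each scalar $i^c\in\mathcal{L}_1\cap\mathcal{L}_2$ there is a scalar $i^{c'}\in\mathcal{L}_1\cap\mathcal{L}_2$ with $\alpha[i^c]=[i^{c'}]$ and $\beta[i^c]=[i^{c'}]$ (as when both fix the classes of scalars). 2. For MQCA $\alpha,\beta$ on the same $\mathcal{L}/\mathcal{S}$, $\mathrm{Ind}(\alpha\beta)=\mathrm{Ind}(\alpha)+\mathrm{Ind}(\beta)$. In particular $\mathrm{Ind}(\mathrm{id})=0$ and $\mathrm{Ind}(\alpha^{-1})=-\mathrm{Ind}(\alpha)$. 3.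 If $U:\mathcal{L}/\mathcal{S}\to\mathcal{L}'/\mathcal{S}'$ is a locality-preserving isomorphism and $\alpha$ is an MQCA on $\mathcal{L}/\mathcal{S}$, then $U\alpha U^{-1}$ is an MQCA on $\mathcal{L}'/\mathcal{S}'$ and $\mathrm{Ind}(U\alpha U^{-1})=\mathrm{Ind}(\alpha)$. 4. Let $\mathcal{L}=\mathcal{P}$, $\mathcal{S}=\{1\}$, and let $\alpha$ be an automorphism of $\mathcal{P}$ that preserves locality. Then $\alpha$ is an MQCA (its inverse preserves locality too), there is a unitary QCA $\Phi$ (a $*$-automorphism of the algebra of local operators that enlarges supports by at most a constant) with $\Phi(P)=\alpha(P)$ up to a phase for every $P\in\mathcal{P}$, and if $\alpha$ fixes the scalars there is exactly one unitary QCA with $\Phi(P)=\alpha(P)$ for all $P\in\mathcal{P}$. For every unitary QCA $\Phi$ that agrees with $\alpha$ on Pauli operators up to phases, $2^{\mathrm{Ind}(\alpha)}$ equals the GNVW index of $\Phi$. Here the GNVW index is computed as follows. Group the sites into consecutive nonempty finite cells $C_i$ ($i\in\mathbb{Z}$) such that $\Phi$ maps $\mathcal{A}(C_i)$ into $\mathcal{A}(C_{i-1}\cup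 C_i\cup C_{i+1})$ for all $i$, where $\mathcal{A}(C)$ is the algebra of operators on the qubits in $C$. The index is $$\sqrt{\frac{\dim\big(\Phi(\mathcal{A}(C_i\cup C_{i+1}))\cap\mathcal{A}(C_{i+1}\cup C_{i+2})\big)}{\dim\mathcal{A}(C_{i+1})}},$$ which is the same for every such grouping (one exists) and every $i$. The translation of one qubit per site by one site to the right has GNVW index $2$. -/

import Mathlib

noncomputable section

/-! ### Pauli operators on a one-dimensional lattice of qubits -/

/-- A set of qubits placed on the sites of the lattice `ℤ`, finitely many on each site. -/
structure QubitChain where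
  Qubit : Type
  site : Qubit → ℤ
  finite_site : ∀ k : ℤ, (site ⁻¹' {k}).Finite

/-- The finitely supported Pauli operator `i ^ phase * ∏ X_j ^ (x j) * ∏ Z_j ^ (z j)`. -/
@[ext] structure PauliOp (N : Type) where
  phase : ZMod 4
  x : N →₀ ZMod 2
  z : N →₀ ZMod 2

/-- The number `∑ j, z j * x j` modulo 2. -/
def bitDot {N : Type} (z x : N →₀ ZMod 2) : ZMod 2 := x.sum fun j b => z j * b

theorem bitDot_add_right {N : Type} (z x y : N →₀ ZMod 2) :
    bitDot z (x + y) = bitDot z x + bitDot z y := by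
  classical
  unfold bitDot
  exact Finsupp.sum_add_index' (by simp) (by intros; ring)

theorem bitDot_add_left {N : Type} (z w x : N →₀ ZMod 2) :
    bitDot (z + w) x = bitDot z x + bitDot w x := by
  unfold bitDot
  simp [Finsupp.sum, add_mul, Finset.sum_add_distrib]

theorem bitDot_zero_right {N : Type} (z : N →₀ ZMod 2) : bitDot z 0 = 0 := by simp [bitDot]

theorem bitDot_zero_left {N : Type} (x : N →₀ ZMod 2) : bitDot 0 x = 0 := by simp [bitDot]

/-- The exponent `e` with `(-1) ^ t = i ^ e`. -/
def signPhase : ZMod 2 →+ ZMod 4 where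
  toFun t := if t = 0 then 0 else 2
  map_zero' := by decide
  map_add' := by decide

namespace PauliOp

variable {N : Type}

/-- Operator multiplication; moving `Z ^ z` past `X ^ y` costs the sign `(-1) ^ (z · y)`. -/
instance : Mul (PauliOp N) :=
  ⟨fun p q => ⟨p.phase + q.phase + signPhase (bitDot p.z q.x), p.x + q.x, p.z + q.z⟩⟩

instance : One (PauliOp N) := ⟨⟨0, 0, 0⟩⟩

instance : Inv (PauliOp N) :=
  ⟨fun p => ⟨-p.phase + signPhase (bitDot p.z p.x), p.x, p.z⟩⟩

@[simp] theorem mul_phase (p q : PauliOp N) :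
    (p * q).phase = p.phase + q.phase + signPhase (bitDot p.z q.x) := rfl
@[simp] theorem mul_x (p q : PauliOp N) : (p * q).x = p.x + q.x := rfl
@[simp] theorem mul_z (p q : PauliOp N) : (p * q).z = p.z + q.z := rfl
@[simp] theorem one_phase : (1 : PauliOp N).phase = 0 := rfl
@[simp] theorem one_x : (1 : PauliOp N).x = 0 := rfl
@[simp] theorem one_z : (1 : PauliOp N).z = 0 := rfl
@[simp] theorem inv_phase (p : PauliOp N) :
    p⁻¹.phase = -p.phase + signPhase (bitDot p.z p.x) := rfl
@[simp] theorem inv_x (p : PauliOp N) : p⁻¹.x = p.x := rfl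
@[simp] theorem inv_z (p : PauliOp N) : p⁻¹.z = p.z := rfl

theorem bits_add_self (x : N →₀ ZMod 2) : x + x = 0 := by
  ext j
  exact CharTwo.add_self_eq_zero (x j)

theorem signPhase_add_self (t : ZMod 2) : signPhase t + signPhase t = 0 := by
  rw [← map_add, CharTwo.add_self_eq_zero, map_zero]

instance : Group (PauliOp N) where
  mul_assoc p q r := by
    ext1
    · simp only [mul_phase, mul_x, mul_z, bitDot_add_left, bitDot_add_right, map_add]; abel
    · simp only [mul_x, add_assoc]
    · simp only [mul_z, add_assoc]
  one_mul p := by ext1 <;> simp [bitDot_zero_left]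
  mul_one p := by ext1 <;> simp [bitDot_zero_right]
  inv_mul_cancel p := by
    ext1
    · have h := signPhase_add_self (bitDot p.z p.x)
      simp only [mul_phase, inv_phase, inv_z, one_phase]
      calc _ = signPhase (bitDot p.z p.x) + signPhase (bitDot p.z p.x) := by abel
        _ = 0 := h
    · simp [bits_add_self]
    · simp [bits_add_self]

/-- The scalar operator `i ^ c`. -/
def scalar (c : ZMod 4) : PauliOp N := ⟨c, 0, 0⟩

end PauliOp

namespace QubitChain

/-- The Pauli group `𝒫` of a chain. -/
abbrev Pauli (Λ : QubitChain) : Type := PauliOp Λ.Qubit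

/-- The set of sites on which a Pauli operator acts nontrivially. -/
def supp (Λ : QubitChain) (p : Λ.Pauli) : Set ℤ :=
  {k | ∃ j : Λ.Qubit, Λ.site j = k ∧ (p.x j ≠ 0 ∨ p.z j ≠ 0)}

/-- The Pauli operators supported on the region `R`. -/
def supportedOn (Λ : QubitChain) (R : Set ℤ) : Subgroup Λ.Pauli where
  carrier := {p | Λ.supp p ⊆ R}
  one_mem' := by
    rintro k ⟨j, -, h⟩
    simp at h
  mul_mem' := by
    rintro p q hp hq k ⟨j, hj, h⟩
    by_cases hpj : p.x j ≠ 0 ∨ p.z j ≠ 0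
    · exact hp ⟨j, hj, hpj⟩
    · push Not at hpj
      exact hq ⟨j, hj, by simpa [hpj.1, hpj.2] using h⟩
  inv_mem' := by
    rintro p hp k ⟨j, hj, h⟩
    exact hp ⟨j, hj, by simpa using h⟩

end QubitChain

/-- The `r`-neighbourhood of a region of `ℤ`. -/
def nbhd (r : ℕ) (R : Set ℤ) : Set ℤ := {k | ∃ i ∈ R, |k - i| ≤ r}

/-! ### Locality-preserving maps and MQCA -/

section

variable {Λ Λ' : QubitChain}

/-- A homomorphism `U : ℒ/𝒮 → ℒ'/𝒮'` such that, for some constant `r` and every `P ∈ ℒ`, the image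
`U [P]` has a representative supported on the `r`-neighbourhood of the support of `P`. -/
def LocalityPreserving {L : Subgroup Λ.Pauli} {S : Subgroup L} [S.Normal]
    {L' : Subgroup Λ'.Pauli} {S' : Subgroup L'} [S'.Normal] (U : L ⧸ S →* L' ⧸ S') : Prop :=
  ∃ r : ℕ, ∀ P : L, ∃ Q : L', U (QuotientGroup.mk P) = QuotientGroup.mk Q ∧
    Λ'.supp Q ⊆ nbhd r (Λ.supp P)

/-- An isomorphism that is locality preserving in both directions. -/
def LocalityPreservingIso {L : Subgroup Λ.Pauli} {S : Subgroup L} [S.Normal]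
    {L' : Subgroup Λ'.Pauli} {S' : Subgroup L'} [S'.Normal] (U : L ⧸ S ≃* L' ⧸ S') : Prop :=
  LocalityPreserving U.toMonoidHom ∧ LocalityPreserving U.symm.toMonoidHom

theorem nbhd_mono {r : ℕ} {R R' : Set ℤ} (h : R ⊆ R') : nbhd r R ⊆ nbhd r R' := by
  rintro k ⟨i, hi, hk⟩
  exact ⟨i, h hi, hk⟩

theorem nbhd_nbhd (r s : ℕ) (R : Set ℤ) : nbhd r (nbhd s R) ⊆ nbhd (r + s) R := by
  rintro k ⟨i, ⟨j, hj, hij⟩, hki⟩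
  refine ⟨j, hj, ?_⟩
  have := abs_sub_le k i j
  push_cast
  linarith

theorem LocalityPreserving.id {L : Subgroup Λ.Pauli} {S : Subgroup L} [S.Normal] :
    LocalityPreserving (MonoidHom.id (L ⧸ S)) :=
  ⟨0, fun P => ⟨P, rfl, fun k hk => ⟨k, hk, by simp⟩⟩⟩

theorem LocalityPreserving.mul {L : Subgroup Λ.Pauli} {S : Subgroup L} [S.Normal]
    {α β : MulAut (L ⧸ S)} (hα : LocalityPreserving α.toMonoidHom)
    (hβ : LocalityPreserving β.toMonoidHom) :
    LocalityPreserving (α * β : MulAut (L ⧸ S)).toMonoidHom := by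
  obtain ⟨r, hr⟩ := hα
  obtain ⟨s, hs⟩ := hβ
  refine ⟨r + s, fun P => ?_⟩
  obtain ⟨Q, hQ, hQs⟩ := hs P
  obtain ⟨T, hT, hTs⟩ := hr Q
  refine ⟨T, ?_, hTs.trans ((nbhd_mono hQs).trans (nbhd_nbhd r s _))⟩
  change α (β (QuotientGroup.mk P)) = _
  change β (QuotientGroup.mk P) = _ at hQ
  rw [hQ]
  exact hT

/-- The group of MQCA on `ℒ/𝒮`: automorphisms that are locality preserving together with their
inverse.  The product `α * β` is composition, `β` being applied first. -/
def MQCA (L : Subgroup Λ.Pauli) (S : Subgroup L) [S.Normal] : Subgroup (MulAut (L ⧸ S)) where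
  carrier := {α | LocalityPreservingIso α}
  one_mem' := ⟨LocalityPreserving.id, LocalityPreserving.id⟩
  mul_mem' := by
    rintro α β ⟨h1, h2⟩ ⟨h3, h4⟩
    refine ⟨h1.mul h3, ?_⟩
    change LocalityPreserving (α * β)⁻¹.toMonoidHom
    rw [mul_inv_rev]
    exact LocalityPreserving.mul (α := β⁻¹) (β := α⁻¹) h4 h2
  inv_mem' := by
    rintro α ⟨h1, h2⟩
    exact ⟨h2, h1⟩

/-! ### The space `ℱ` and the index -/

/-- The classes in `ℒ/𝒮` that have a representative supported on `R`. -/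
def classesOn (L : Subgroup Λ.Pauli) (S : Subgroup L) [S.Normal] (R : Set ℤ) :
    Subgroup (L ⧸ S) :=
  ((Λ.supportedOn R).subgroupOf L).map (QuotientGroup.mk' S)

def classesAtPosInf (L : Subgroup Λ.Pauli) (S : Subgroup L) [S.Normal] : Subgroup (L ⧸ S) :=
  ⨅ k : ℤ, classesOn L S (Set.Ioi k)

def classesAtNegInf (L : Subgroup Λ.Pauli) (S : Subgroup L) [S.Normal] : Subgroup (L ⧸ S) :=
  ⨅ k : ℤ, classesOn L S (Set.Iio k)

def classesAtInf (L : Subgroup Λ.Pauli) (S : Subgroup L) [S.Normal] : Subgroup (L ⧸ S) :=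
  classesAtNegInf L S ⊔ classesAtPosInf L S

theorem supportedOn_conj_mem {R : Set ℤ} {p : Λ.Pauli} (hp : p ∈ Λ.supportedOn R) (g : Λ.Pauli) :
    g * p * g⁻¹ ∈ Λ.supportedOn R := by
  rintro k ⟨j, hj, h⟩
  refine hp ⟨j, hj, ?_⟩
  have e : ∀ a b : ZMod 2, a + b + a = b := by decide
  simpa [e] using h

instance classesOn_normal (L : Subgroup Λ.Pauli) (S : Subgroup L) [S.Normal] (R : Set ℤ) :
    (classesOn L S R).Normal := by
  have : ((Λ.supportedOn R).subgroupOf L).Normal :=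
    ⟨fun p hp g => supportedOn_conj_mem (Λ := Λ) hp (g : Λ.Pauli)⟩
  exact this.map _ (QuotientGroup.mk'_surjective S)

instance classesAtPosInf_normal (L : Subgroup Λ.Pauli) (S : Subgroup L) [S.Normal] :
    (classesAtPosInf L S).Normal := Subgroup.normal_iInf_normal fun _ => inferInstance

instance classesAtNegInf_normal (L : Subgroup Λ.Pauli) (S : Subgroup L) [S.Normal] :
    (classesAtNegInf L S).Normal := Subgroup.normal_iInf_normal fun _ => inferInstance

instance classesAtInf_normal (L : Subgroup Λ.Pauli) (S : Subgroup L) [S.Normal] :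
    (classesAtInf L S).Normal := by
  unfold classesAtInf; infer_instance

/-- A class represented by a scalar lies in the subgroup at infinity. -/
theorem mk_mem_classesAtInf {L : Subgroup Λ.Pauli} {S : Subgroup L} [S.Normal] (P : L)
    (hx : (P : Λ.Pauli).x = 0) (hz : (P : Λ.Pauli).z = 0) :
    (QuotientGroup.mk P : L ⧸ S) ∈ classesAtInf L S := by
  refine Subgroup.mem_sup_left (Subgroup.mem_iInf.2 fun k => ⟨P, ?_, rfl⟩)
  rintro i ⟨j, -, h⟩
  simp [hx, hz] at h

/-- The group `ℱ = (ℒ/𝒮) / (ℒ₋∞ ℒ₊∞)`. -/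
abbrev FGroup (L : Subgroup Λ.Pauli) (S : Subgroup L) [S.Normal] : Type :=
  (L ⧸ S) ⧸ classesAtInf L S

theorem FGroup.mul_comm' {L : Subgroup Λ.Pauli} {S : Subgroup L} [S.Normal] (f g : FGroup L S) :
    f * g = g * f := by
  induction f using QuotientGroup.induction_on with | _ f
  induction g using QuotientGroup.induction_on with | _ g
  induction f using QuotientGroup.induction_on with | _ P
  induction g using QuotientGroup.induction_on with | _ Q
  refine QuotientGroup.eq.2 ?_
  have e : ∀ a b : ZMod 2, a + b + (a + b) = 0 := by decide
  refine mk_mem_classesAtInf ((P * Q)⁻¹ * (Q * P)) ?_ ?_ <;> ext j <;> simp [e]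

theorem FGroup.sq_eq_one {L : Subgroup Λ.Pauli} {S : Subgroup L} [S.Normal] (f : FGroup L S) :
    f ^ 2 = 1 := by
  induction f using QuotientGroup.induction_on with | _ f
  induction f using QuotientGroup.induction_on with | _ P
  rw [pow_two]
  refine (QuotientGroup.eq_one_iff _).2 ?_
  refine mk_mem_classesAtInf (P * P) ?_ ?_ <;> simp [PauliOp.bits_add_self]

instance (L : Subgroup Λ.Pauli) (S : Subgroup L) [S.Normal] : CommGroup (FGroup L S) :=
  { (inferInstance : Group (FGroup L S)) with mul_comm := FGroup.mul_comm' }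

/-- `ℱ` written additively: a vector space over the field with two elements. -/
abbrev FSpace (L : Subgroup Λ.Pauli) (S : Subgroup L) [S.Normal] : Type := Additive (FGroup L S)

instance (L : Subgroup Λ.Pauli) (S : Subgroup L) [S.Normal] : Module (ZMod 2) (FSpace L S) :=
  AddCommGroup.zmodModule (n := 2) fun f => FGroup.sq_eq_one f.toMul

/-- The subspace `ℱ_{<a}` of `ℱ`. -/
def FBelow (L : Subgroup Λ.Pauli) (S : Subgroup L) [S.Normal] (a : ℤ) :
    Submodule (ZMod 2) (FSpace L S) :=
  AddSubgroup.toZModSubmodule 2 (Subgroup.toAddSubgroup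
    ((classesOn L S (Set.Iio a) ⊔ classesAtPosInf L S).map
      (QuotientGroup.mk' (classesAtInf L S))))

theorem LocalityPreserving.map_classesAtInf_le {L : Subgroup Λ.Pauli} {S : Subgroup L} [S.Normal]
    {U : L ⧸ S →* L ⧸ S} (hU : LocalityPreserving U) :
    classesAtInf L S ≤ (classesAtInf L S).comap U := by
  obtain ⟨r, hr⟩ := hU
  refine sup_le (fun f hf => Subgroup.mem_sup_left (Subgroup.mem_iInf.2 fun k => ?_))
    (fun f hf => Subgroup.mem_sup_right (Subgroup.mem_iInf.2 fun k => ?_))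
  · obtain ⟨P, hP, rfl⟩ := Subgroup.mem_iInf.1 hf (k - r)
    obtain ⟨Q, hQ, hQs⟩ := hr P
    refine ⟨Q, fun i hi => ?_, hQ.symm⟩
    obtain ⟨j, hj, hij⟩ := hQs hi
    have h1 : j < k - r := hP hj
    have h2 := (abs_le.1 hij).2
    simp only [Set.mem_Iio]; linarith
  · obtain ⟨P, hP, rfl⟩ := Subgroup.mem_iInf.1 hf (k + r)
    obtain ⟨Q, hQ, hQs⟩ := hr P
    refine ⟨Q, fun i hi => ?_, hQ.symm⟩
    obtain ⟨j, hj, hij⟩ := hQs hi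
    have h1 : k + r < j := hP hj
    have h2 := (abs_le.1 hij).1
    simp only [Set.mem_Ioi]; linarith

variable {L : Subgroup Λ.Pauli} {S : Subgroup L} [S.Normal]

/-- The linear map `ᾱ : ℱ → ℱ` induced by an MQCA `α`. -/
def inducedMap (α : MQCA L S) : FSpace L S →ₗ[ZMod 2] FSpace L S :=
  AddMonoidHom.toZModLinearMap 2 (MonoidHom.toAdditive
    (QuotientGroup.map (classesAtInf L S) (classesAtInf L S) (α : MulAut (L ⧸ S)).toMonoidHom
      α.2.1.map_classesAtInf_le))

/-- The map `φ = ν ᾱ ι : ℱ₀ → ℱ₀`, where `ν` is a projection of `ℱ` onto `ℱ₀`. -/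
def cutMap (α : MQCA L S) (F₀ : Submodule (ZMod 2) (FSpace L S))
    (ν : FSpace L S →ₗ[ZMod 2] FSpace L S) (hν : LinearMap.IsProj F₀ ν) : F₀ →ₗ[ZMod 2] F₀ :=
  hν.codRestrict ∘ₗ inducedMap α ∘ₗ F₀.subtype

end

/-- A linear map with finite-dimensional kernel and cokernel. -/
def FredholmMap {K V W : Type} [Field K] [AddCommGroup V] [Module K V] [AddCommGroup W]
    [Module K W] (φ : V →ₗ[K] W) : Prop :=
  FiniteDimensional K (LinearMap.ker φ) ∧ FiniteDimensional K (W ⧸ LinearMap.range φ)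

def fredholmIndex {K V W : Type} [Field K] [AddCommGroup V] [Module K V] [AddCommGroup W]
    [Module K W] (φ : V →ₗ[K] W) : ℤ :=
  (Module.finrank K (LinearMap.ker φ) : ℤ) - Module.finrank K (W ⧸ LinearMap.range φ)

theorem exists_isProj {K V : Type} [Field K] [AddCommGroup V] [Module K V] (p : Submodule K V) :
    ∃ ν : V →ₗ[K] V, LinearMap.IsProj p ν := by
  obtain ⟨f, hf⟩ := p.subtype.exists_leftInverse_of_injective p.ker_subtype
  refine ⟨p.subtype ∘ₗ f, fun v => (f v).2, fun v hv => ?_⟩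
  have := LinearMap.congr_fun hf ⟨v, hv⟩
  simpa using congrArg Subtype.val this

/-- The MQCA index `Ind(α) = ½ ind(ν ᾱ ι)`, computed with `ℱ₀ = ℱ_{<0}` and some projection `ν`. -/
def Ind {Λ : QubitChain} {L : Subgroup Λ.Pauli} {S : Subgroup L} [S.Normal] (α : MQCA L S) : ℚ :=
  (1 / 2 : ℚ) * fredholmIndex (cutMap α (FBelow L S 0) (exists_isProj (FBelow L S 0)).choose
    (exists_isProj (FBelow L S 0)).choose_spec)

/-! ### Double layers -/

namespace QubitChain

/-- The double layer system. -/
def stack (Λ₁ Λ₂ : QubitChain) : QubitChain where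
  Qubit := Λ₁.Qubit ⊕ Λ₂.Qubit
  site := Sum.elim Λ₁.site Λ₂.site
  finite_site k := by
    rw [Set.preimage_sumElim]
    exact ((Λ₁.finite_site k).image _).union ((Λ₂.finite_site k).image _)

end QubitChain

/-- The bit string on `N ⊕ M` whose restrictions are `x` and `y`. -/
def bitSum {N M : Type} (x : N →₀ ZMod 2) (y : M →₀ ZMod 2) : N ⊕ M →₀ ZMod 2 :=
  Finsupp.sumElim x y

theorem bitSum_add {N M : Type} (x x' : N →₀ ZMod 2) (y y' : M →₀ ZMod 2) :
    bitSum (x + x') (y + y') = bitSum x y + bitSum x' y' := by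
  ext (j | j) <;> simp [bitSum]

theorem bitDot_bitSum {N M : Type} (z x : N →₀ ZMod 2) (w y : M →₀ ZMod 2) :
    bitDot (bitSum z w) (bitSum x y) = bitDot z x + bitDot w y := by
  simp only [bitDot, bitSum, Finsupp.sum_sumElim]
  rfl

/-- The homomorphism `(P, Q) ↦ P ⊗ Q`. -/
def pauliTensor (Λ₁ Λ₂ : QubitChain) : Λ₁.Pauli × Λ₂.Pauli →* (Λ₁.stack Λ₂).Pauli where
  toFun p := ⟨p.1.phase + p.2.phase, bitSum p.1.x p.2.x, bitSum p.1.z p.2.z⟩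
  map_one' := by
    refine PauliOp.ext (by simp) ?_ ?_ <;> ext (j | j) <;> rfl
  map_mul' p q := by
    refine PauliOp.ext ?_ (bitSum_add _ _ _ _) (bitSum_add _ _ _ _)
    have h := congrArg signPhase (bitDot_bitSum p.1.z q.1.x p.2.z q.2.x)
    rw [map_add] at h
    refine Eq.trans ?_ (congrArg (p.1.phase + p.2.phase + (q.1.phase + q.2.phase) + ·) h.symm)
    simp only [Prod.fst_mul, Prod.snd_mul, PauliOp.mul_phase]
    abel

section

variable {Λ₁ Λ₂ : QubitChain}

/-- The group `{P ⊗ Q | P ∈ L₁, Q ∈ L₂}`. -/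
def tensorGroup (L₁ : Subgroup Λ₁.Pauli) (L₂ : Subgroup Λ₂.Pauli) :
    Subgroup (Λ₁.stack Λ₂).Pauli :=
  (L₁.prod L₂).map (pauliTensor Λ₁ Λ₂)

/-- The element `P ⊗ Q` of `L₁ ⊗ L₂`. -/
def tensorElt {L₁ : Subgroup Λ₁.Pauli} {L₂ : Subgroup Λ₂.Pauli} (P : L₁) (Q : L₂) :
    tensorGroup L₁ L₂ :=
  ⟨pauliTensor Λ₁ Λ₂ (P, Q), (P, Q), ⟨P.2, Q.2⟩, rfl⟩

/-- The subgroup `{P ⊗ Q | P ∈ S₁, Q ∈ S₂}` of `L₁ ⊗ L₂`. -/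
def tensorSubgroup {L₁ : Subgroup Λ₁.Pauli} {L₂ : Subgroup Λ₂.Pauli}
    (S₁ : Subgroup L₁) (S₂ : Subgroup L₂) : Subgroup (tensorGroup L₁ L₂) where
  carrier := {T | ∃ P ∈ S₁, ∃ Q ∈ S₂, T = tensorElt P Q}
  one_mem' := ⟨1, one_mem _, 1, one_mem _, Subtype.ext (map_one (pauliTensor Λ₁ Λ₂)).symm⟩
  mul_mem' := by
    rintro _ _ ⟨P, hP, Q, hQ, rfl⟩ ⟨P', hP', Q', hQ', rfl⟩
    exact ⟨P * P', mul_mem hP hP', Q * Q', mul_mem hQ hQ',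
      Subtype.ext (map_mul (pauliTensor Λ₁ Λ₂) _ _).symm⟩
  inv_mem' := by
    rintro _ ⟨P, hP, Q, hQ, rfl⟩
    exact ⟨P⁻¹, inv_mem hP, Q⁻¹, inv_mem hQ, Subtype.ext (map_inv (pauliTensor Λ₁ Λ₂) _).symm⟩

instance tensorSubgroup_normal {L₁ : Subgroup Λ₁.Pauli} {L₂ : Subgroup Λ₂.Pauli}
    (S₁ : Subgroup L₁) (S₂ : Subgroup L₂) [hS₁ : S₁.Normal] [hS₂ : S₂.Normal] :
    (tensorSubgroup S₁ S₂).Normal := by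
  constructor
  rintro _ ⟨P, hP, Q, hQ, rfl⟩ ⟨_, ⟨A, B⟩, ⟨hA, hB⟩, rfl⟩
  refine ⟨_, hS₁.conj_mem P hP ⟨A, hA⟩, _, hS₂.conj_mem Q hQ ⟨B, hB⟩, Subtype.ext ?_⟩
  change pauliTensor Λ₁ Λ₂ (A, B) * pauliTensor Λ₁ Λ₂ (P, Q) * (pauliTensor Λ₁ Λ₂ (A, B))⁻¹ = _
  rw [← map_mul, ← map_inv, ← map_mul]
  rfl

variable {L₁ : Subgroup Λ₁.Pauli} {S₁ : Subgroup L₁} [S₁.Normal]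
  {L₂ : Subgroup Λ₂.Pauli} {S₂ : Subgroup L₂} [S₂.Normal]

/-- `γ = α ⊗ β`: the MQCA `γ` of the double layer acts as `α` on the first layer and as `β` on the
second layer. -/
def IsTensor (α : MQCA L₁ S₁) (β : MQCA L₂ S₂)
    (γ : MQCA (tensorGroup L₁ L₂) (tensorSubgroup S₁ S₂)) : Prop :=
  ∀ (P P' : L₁) (Q Q' : L₂),
    (α : MulAut (L₁ ⧸ S₁)) (QuotientGroup.mk P) = QuotientGroup.mk P' →
    (β : MulAut (L₂ ⧸ S₂)) (QuotientGroup.mk Q) = QuotientGroup.mk Q' →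
    (γ : MulAut (tensorGroup L₁ L₂ ⧸ tensorSubgroup S₁ S₂))
      (QuotientGroup.mk (tensorElt P Q)) = QuotientGroup.mk (tensorElt P' Q')

/-- `α` and `β` act in the same way on the scalars contained in both logical groups: each such
scalar is mapped by `α` and by `β` to the class of one and the same scalar. -/
def AgreeOnScalars (α : MQCA L₁ S₁) (β : MQCA L₂ S₂) : Prop :=
  ∀ (c : ZMod 4) (h₁ : PauliOp.scalar c ∈ L₁) (h₂ : PauliOp.scalar c ∈ L₂),
    ∃ (c' : ZMod 4) (h₁' : PauliOp.scalar c' ∈ L₁) (h₂' : PauliOp.scalar c' ∈ L₂),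
      (α : MulAut (L₁ ⧸ S₁)) (QuotientGroup.mk ⟨_, h₁⟩) = QuotientGroup.mk ⟨_, h₁'⟩ ∧
      (β : MulAut (L₂ ⧸ S₂)) (QuotientGroup.mk ⟨_, h₂⟩) = QuotientGroup.mk ⟨_, h₂'⟩

end

/-! ### Unitary QCA and their GNVW index -/

section

variable (Λ : QubitChain)

/-- The span of the computational basis states `|s⟩`, `s` a finitely supported bit string. -/
abbrev StateSpace : Type := (Λ.Qubit →₀ ZMod 2) →₀ ℂ

variable {Λ}

/-- The operator `i ^ c X ^ x Z ^ z : |s⟩ ↦ i ^ c (-1) ^ (z · s) |s + x⟩`. -/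
def pauliAct (p : Λ.Pauli) : Module.End ℂ (StateSpace Λ) :=
  Finsupp.linearCombination ℂ fun s =>
    Finsupp.single (s + p.x) (Complex.I ^ (p.phase + signPhase (bitDot p.z s)).val)

theorem I_pow_val_add (c d : ZMod 4) :
    Complex.I ^ (c + d).val = Complex.I ^ c.val * Complex.I ^ d.val := by
  rw [← pow_add, ZMod.val_add]
  exact (pow_eq_pow_mod _ Complex.I_pow_four).symm

theorem pauliAct_mul (p q : Λ.Pauli) : pauliAct (p * q) = pauliAct p * pauliAct q := by
  refine Finsupp.lhom_ext' fun s => LinearMap.ext_ring ?_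
  simp only [pauliAct, LinearMap.comp_apply, Finsupp.lsingle_apply, Module.End.mul_apply,
    Finsupp.linearCombination_single, one_smul, PauliOp.mul_phase, PauliOp.mul_x, PauliOp.mul_z,
    Finsupp.smul_single, smul_eq_mul, bitDot_add_left, bitDot_add_right, map_add]
  rw [← I_pow_val_add]
  have h1 : s + (p.x + q.x) = s + q.x + p.x := by abel
  have h2 : p.phase + q.phase + signPhase (bitDot p.z q.x) +
      (signPhase (bitDot p.z s) + signPhase (bitDot q.z s)) =
      q.phase + signPhase (bitDot q.z s) +
        (p.phase + (signPhase (bitDot p.z s) + signPhase (bitDot p.z q.x))) := by abel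
  rw [h1, h2]

variable (Λ)

/-- The algebra of all local operators, spanned by the finitely supported Pauli operators.  It is
the algebraic tensor product of the `2 × 2` matrix algebras of all qubits. -/
def LocalAlg : Subalgebra ℂ (Module.End ℂ (StateSpace Λ)) :=
  Algebra.adjoin ℂ (Set.range (pauliAct (Λ := Λ)))

variable {Λ}

/-- A Pauli operator as a local operator. -/
def localPauli (p : Λ.Pauli) : LocalAlg Λ := ⟨pauliAct p, Algebra.subset_adjoin ⟨p, rfl⟩⟩

/-- The local operators supported on `R`, generated by the Pauli operators supported on `R`.  For
finite `R` this is the full matrix algebra of the qubits in `R`. -/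
def localOn (Λ : QubitChain) (R : Set ℤ) : Subalgebra ℂ (LocalAlg Λ) :=
  Algebra.adjoin ℂ (localPauli '' (Λ.supportedOn R : Set Λ.Pauli))

/-- `B` is the adjoint of `A`, in terms of matrix elements `⟨t|A|s⟩`. -/
def IsAdjointOp (A B : LocalAlg Λ) : Prop :=
  ∀ s t : Λ.Qubit →₀ ZMod 2,
    (B : Module.End ℂ (StateSpace Λ)) (Finsupp.single s 1) t =
      star ((A : Module.End ℂ (StateSpace Λ)) (Finsupp.single t 1) s)

/-- A (unitary) QCA: an automorphism of the `*`-algebra of local operators that enlarges supports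
at most by some constant `r`. -/
def IsUnitaryQCA (Φ : LocalAlg Λ ≃ₐ[ℂ] LocalAlg Λ) : Prop :=
  (∀ A B, IsAdjointOp A B → IsAdjointOp (Φ A) (Φ B)) ∧
  ∃ r : ℕ, ∀ R : Set ℤ, (localOn Λ R).map (Φ : LocalAlg Λ →ₐ[ℂ] LocalAlg Λ) ≤ localOn Λ (nbhd r R)

/-- After grouping the sites into the cells `C i = [m i, m (i + 1))`, the image of the algebra of a
cell is contained in the algebra of the cell and its two neighbours. -/
def IsNearestNeighbor (Φ : LocalAlg Λ ≃ₐ[ℂ] LocalAlg Λ) (m : ℤ → ℤ) : Prop :=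
  StrictMono m ∧ ∀ i : ℤ,
    (localOn Λ (Set.Ico (m i) (m (i + 1)))).map (Φ : LocalAlg Λ →ₐ[ℂ] LocalAlg Λ) ≤
      localOn Λ (Set.Ico (m (i - 1)) (m (i + 2)))

/-- The right-moving algebra `Φ(𝒜(C i ∪ C (i + 1))) ∩ 𝒜(C (i + 1) ∪ C (i + 2))`. -/
def rightSupportAlg (Φ : LocalAlg Λ ≃ₐ[ℂ] LocalAlg Λ) (m : ℤ → ℤ) (i : ℤ) :
    Subalgebra ℂ (LocalAlg Λ) :=
  (localOn Λ (Set.Ico (m i) (m (i + 2)))).map (Φ : LocalAlg Λ →ₐ[ℂ] LocalAlg Λ) ⊓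
    localOn Λ (Set.Ico (m (i + 1)) (m (i + 3)))

/-- `ι` is the GNVW index of `Φ`: for every grouping of sites that makes `Φ` nearest-neighbour
(there is one), and at every place, `ι` is the square root of
`dim (Φ(𝒜(C i ∪ C (i + 1))) ∩ 𝒜(C (i + 1) ∪ C (i + 2))) / dim 𝒜(C (i + 1))`.
The translation of one qubit per site by one site to the right has index `2`. -/
def IsGNVWIndex (Φ : LocalAlg Λ ≃ₐ[ℂ] LocalAlg Λ) (ι : ℝ) : Prop :=
  (∃ m, IsNearestNeighbor Φ m) ∧ ∀ m, IsNearestNeighbor Φ m → ∀ i : ℤ,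
    ι = √((Module.finrank ℂ (rightSupportAlg Φ m i) : ℝ) /
      Module.finrank ℂ (localOn Λ (Set.Ico (m (i + 1)) (m (i + 2)))))

/-- `Φ` acts on Pauli operators as `α` does, up to phase factors. -/
def ImplementsUpToPhase (Φ : LocalAlg Λ ≃ₐ[ℂ] LocalAlg Λ)
    (α : MulAut ((⊤ : Subgroup Λ.Pauli) ⧸ (⊥ : Subgroup (⊤ : Subgroup Λ.Pauli)))) : Prop :=
  ∀ P P' : (⊤ : Subgroup Λ.Pauli), α (QuotientGroup.mk P) = QuotientGroup.mk P' →
    ∃ c : ZMod 4, Φ (localPauli (P : Λ.Pauli)) = localPauli (PauliOp.scalar c * (P' : Λ.Pauli))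

/-- `Φ` extends `α`. -/
def Implements (Φ : LocalAlg Λ ≃ₐ[ℂ] LocalAlg Λ)
    (α : MulAut ((⊤ : Subgroup Λ.Pauli) ⧸ (⊥ : Subgroup (⊤ : Subgroup Λ.Pauli)))) : Prop :=
  ∀ P P' : (⊤ : Subgroup Λ.Pauli), α (QuotientGroup.mk P) = QuotientGroup.mk P' →
    Φ (localPauli (P : Λ.Pauli)) = localPauli (P' : Λ.Pauli)

/-- `α` fixes the scalars. -/
def FixesScalars
    (α : MulAut ((⊤ : Subgroup Λ.Pauli) ⧸ (⊥ : Subgroup (⊤ : Subgroup Λ.Pauli)))) : Prop :=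
  ∀ c : ZMod 4, α (QuotientGroup.mk ⟨PauliOp.scalar c, trivial⟩) =
    QuotientGroup.mk ⟨PauliOp.scalar c, trivial⟩

end

end

/-! The index is a relative dimension. Write `[W₁ : W₂]` for the difference of the dimensions of two
commensurable subspaces (`relDim`). Only finitely many qubits lie between two sites, so `ℱ_{<b} /
ℱ_{<a}` is finite-dimensional (`finiteRelCodim_FBelow`). Since `α` and its inverse move supports by
a bounded distance, `ᾱ` carries a cut `W` of `ℱ` to a commensurable cut
(`LocalityPreservingIso.isCut_map`). On a subspace of finite codimension in `W` that `ᾱ` maps into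
`W`, the projection does nothing, whence `φ` is Fredholm of index `[ᾱW : W]`
(`fredholmIndex_compression`).

Relative dimension is additive, `[W₁ : W₂] + [W₂ : W₃] = [W₁ : W₃]`, and invariant under linear
isomorphisms. Independence of the cut, additivity under composition and invariance under conjugation
are formal consequences. For tensor products, the kernel of `([P], [Q]) ↦ [P ⊗ Q]` consists of the
pairs `([i^c], [i^c]⁻¹)` (`mem_ker_tensorClass`). Hence `α ⊗ β` exists exactly when `α × β` respects
these pairs; scalars vanish in `ℱ`, so the `ℱ`-space of the double layer is the product of the two
`ℱ`-spaces (`tensorFMap_bijective`).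

For the full Pauli group, `ℱ` is the space of binary vectors `(x, z)`. An automorphism preserves
commutation, and an operator commuting with all Paulis on `R` is supported off `R`; this makes the
inverse local (`supp_symm_subset`). The Paulis `X^x Z^z` form a basis of the local algebra, so an
automorphism fixing scalars extends linearly; one that does not fix them inverts them and is first
composed with complex conjugation. A QCA extending the automorphism up to phases permutes this basis
up to scalars, so the algebras in the GNVW formula have dimensions `2^(dim T)` and `2^(dim C)` for
spaces `T`, `C` of binary vectors. With `X` the vectors left of `C` and `W = X ⊕ C`, one finds `ᾱW =
X ⊕ T` (`MapsCells.relDim_eq`), so `[ᾱW : W] = dim T - dim C`; the factor `1/2` in `Ind` is the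
square root in the GNVW formula. -/

noncomputable section

/-! ### Relative dimension of commensurable subspaces -/

section RelativeDimension

variable {K V V' : Type} [Field K] [AddCommGroup V] [Module K V] [AddCommGroup V'] [Module K V']

/-- The dimension of `Y / (X ∩ Y)`. -/
def relCodim (X Y : Submodule K V) : ℕ := Module.finrank K (Y.map X.mkQ)

/-- `Y / (X ∩ Y)` is finite-dimensional. -/
def FiniteRelCodim (X Y : Submodule K V) : Prop := FiniteDimensional K (Y.map X.mkQ)

/-- The difference of the dimensions of two commensurable subspaces. -/
def relDim (W₁ W₂ : Submodule K V) : ℤ := (relCodim W₂ W₁ : ℤ) - relCodim W₁ W₂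

/-- Both images are the quotient of `Y` by the same kernel. This allows a relative codimension to be
computed with any linear map that vanishes on `Y` exactly along `X`. -/
theorem nonempty_map_equiv_map {V'' : Type} [AddCommGroup V''] [Module K V''] (f : V →ₗ[K] V')
    (g : V →ₗ[K] V'') (Y : Submodule K V) (h : ∀ y ∈ Y, f y = 0 ↔ g y = 0) :
    Nonempty (Y.map f ≃ₗ[K] Y.map g) := by
  rw [← LinearMap.range_domRestrict, ← LinearMap.range_domRestrict]
  have e : LinearMap.ker (f.domRestrict Y) = LinearMap.ker (g.domRestrict Y) := by
    ext y
    simpa using h y y.2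
  exact ⟨(f.domRestrict Y).quotKerEquivRange.symm.trans
    ((Submodule.quotEquivOfEq _ _ e).trans (g.domRestrict Y).quotKerEquivRange)⟩

theorem relCodim_eq_finrank_map (f : V →ₗ[K] V') (X Y : Submodule K V)
    (h : ∀ y ∈ Y, f y = 0 ↔ y ∈ X) : relCodim X Y = Module.finrank K (Y.map f) :=
  (nonempty_map_equiv_map X.mkQ f Y fun y hy => by
    rw [h y hy]; simp).some.finrank_eq

theorem finiteRelCodim_iff_map (f : V →ₗ[K] V') (X Y : Submodule K V)
    (h : ∀ y ∈ Y, f y = 0 ↔ y ∈ X) :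
    FiniteRelCodim X Y ↔ FiniteDimensional K (Y.map f) :=
  Module.Finite.equiv_iff (nonempty_map_equiv_map X.mkQ f Y fun y hy => by
    rw [h y hy]; simp).some

theorem finrank_map_add_finrank_inf_ker (f : V →ₗ[K] V') (M : Submodule K V)
    [FiniteDimensional K M] :
    Module.finrank K (M.map f) + Module.finrank K (M ⊓ LinearMap.ker f : Submodule K V) =
      Module.finrank K M := by
  rw [← LinearMap.range_domRestrict, ← (f.domRestrict M).finrank_range_add_finrank_ker]
  congr 1
  have e : (LinearMap.ker (f.domRestrict M)).map M.subtype = M ⊓ LinearMap.ker f := by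
    ext v
    simp only [Submodule.mem_map, LinearMap.mem_ker, LinearMap.domRestrict_apply,
      Submodule.subtype_apply, Submodule.mem_inf]
    exact ⟨by rintro ⟨w, hw, rfl⟩; exact ⟨w.2, hw⟩, fun h => ⟨⟨v, h.1⟩, h.2, rfl⟩⟩
  rw [← e]
  exact Submodule.finrank_map_subtype_eq _ _

/-- `Y' / (X' ∩ Y')` is a quotient of a subspace of `Y / (X ∩ Y)`. -/
theorem FiniteRelCodim.mono {X X' Y Y' : Submodule K V} (h : FiniteRelCodim X Y) (hX : X ≤ X')
    (hY : Y' ≤ Y) : FiniteRelCodim X' Y' := by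
  have : FiniteDimensional K (Y.map X.mkQ) := h
  have e : Y'.map X'.mkQ = (Y'.map X.mkQ).map (Submodule.factor hX) := by
    rw [← Submodule.map_comp, Submodule.factor_comp_mk]
  have : FiniteDimensional K (Y'.map X.mkQ) :=
    Submodule.finiteDimensional_of_le (Submodule.map_mono hY)
  unfold FiniteRelCodim
  rw [e]
  infer_instance

/-- Rank-nullity for `Z / X → Z / Y`, whose kernel is `Y / X`. -/
theorem relCodim_add {X Y Z : Submodule K V} (hXY : X ≤ Y) (hYZ : Y ≤ Z)
    (h : FiniteRelCodim X Z) : relCodim X Z = relCodim X Y + relCodim Y Z := by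
  have : FiniteDimensional K (Z.map X.mkQ) := h
  have h1 := finrank_map_add_finrank_inf_ker (Submodule.factor hXY) (Z.map X.mkQ)
  rw [← Submodule.map_comp, Submodule.factor_comp_mk] at h1
  have e : Z.map X.mkQ ⊓ LinearMap.ker (Submodule.factor hXY) = Y.map X.mkQ := by
    ext v
    obtain ⟨v, rfl⟩ := X.mkQ_surjective v
    rw [Submodule.mem_inf, LinearMap.mem_ker, Submodule.factor_mk, Submodule.mkQ_apply,
      Submodule.mkQ_apply, Submodule.Quotient.mk_eq_zero]
    constructor
    · rintro ⟨-, h⟩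
      exact ⟨v, h, rfl⟩
    · rintro ⟨w, hw, h⟩
      refine ⟨⟨w, hYZ hw, h⟩, ?_⟩
      have := hXY ((Submodule.Quotient.eq X).1 h)
      simpa using Y.sub_mem hw this
  rw [e] at h1
  unfold relCodim
  omega

theorem relCodim_inf_left (X Y : Submodule K V) : relCodim (X ⊓ Y) Y = relCodim X Y := by
  rw [relCodim_eq_finrank_map X.mkQ (X ⊓ Y) Y fun y hy => by simp [hy]]
  rfl

/-- The codimension of `X` in `W₁ ⊓ W₂` is a common summand of both terms and cancels. Measured from
one `X`, identities between relative dimensions become arithmetic. -/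
theorem relDim_eq_sub {X W₁ W₂ : Submodule K V} (h₁ : X ≤ W₁) (h₂ : X ≤ W₂)
    (f₁ : FiniteRelCodim X W₁) (f₂ : FiniteRelCodim X W₂) :
    relDim W₁ W₂ = (relCodim X W₁ : ℤ) - relCodim X W₂ := by
  have e₁ := relCodim_add (le_inf h₁ h₂) inf_le_left f₁
  have e₂ := relCodim_add (le_inf h₁ h₂) inf_le_right f₂
  rw [relCodim_inf_left] at e₂
  rw [inf_comm, relCodim_inf_left, inf_comm] at e₁
  unfold relDim
  omega

theorem relDim_add {X W₁ W₂ W₃ : Submodule K V} (h₁ : X ≤ W₁) (h₂ : X ≤ W₂) (h₃ : X ≤ W₃)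
    (f₁ : FiniteRelCodim X W₁) (f₂ : FiniteRelCodim X W₂) (f₃ : FiniteRelCodim X W₃) :
    relDim W₁ W₂ + relDim W₂ W₃ = relDim W₁ W₃ := by
  rw [relDim_eq_sub h₁ h₂ f₁ f₂, relDim_eq_sub h₂ h₃ f₂ f₃, relDim_eq_sub h₁ h₃ f₁ f₃]
  ring

theorem relCodim_map_equiv (e : V ≃ₗ[K] V') (X Y : Submodule K V) :
    relCodim (X.map (e : V →ₗ[K] V')) (Y.map (e : V →ₗ[K] V')) = relCodim X Y := by
  rw [relCodim_eq_finrank_map ((X.map (e : V →ₗ[K] V')).mkQ ∘ₗ (e : V →ₗ[K] V')) X Y,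
    Submodule.map_comp]
  · rfl
  · intro y _
    simp

theorem relDim_map_equiv (e : V ≃ₗ[K] V') (W₁ W₂ : Submodule K V) :
    relDim (W₁.map (e : V →ₗ[K] V')) (W₂.map (e : V →ₗ[K] V')) = relDim W₁ W₂ := by
  simp only [relDim, relCodim_map_equiv]

theorem finrank_submodule_prod (P : Submodule K V) (Q : Submodule K V') [FiniteDimensional K P]
    [FiniteDimensional K Q] :
    Module.finrank K (P.prod Q) = Module.finrank K P + Module.finrank K Q := by
  have e : P.prod Q = LinearMap.range (P.subtype.prodMap Q.subtype) := by
    rw [LinearMap.range_prodMap, P.range_subtype, Q.range_subtype]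
  rw [e, LinearMap.finrank_range_of_inj, Module.finrank_prod]
  exact Prod.map_injective.2 ⟨P.subtype_injective, Q.subtype_injective⟩

theorem relCodim_prod (X Y : Submodule K V) (X' Y' : Submodule K V') (h : FiniteRelCodim X Y)
    (h' : FiniteRelCodim X' Y') :
    relCodim (X.prod X') (Y.prod Y') = relCodim X Y + relCodim X' Y' := by
  have : FiniteDimensional K (Y.map X.mkQ) := h
  have : FiniteDimensional K (Y'.map X'.mkQ) := h'
  rw [relCodim_eq_finrank_map (X.mkQ.prodMap X'.mkQ), LinearMap.prodMap_map_prod,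
    finrank_submodule_prod]
  · rfl
  · rintro ⟨a, b⟩ _
    simp [Submodule.mem_prod]

theorem relDim_prod (W₁ W₂ : Submodule K V) (W₁' W₂' : Submodule K V')
    (h₁ : FiniteRelCodim W₁ W₂) (h₂ : FiniteRelCodim W₂ W₁) (h₁' : FiniteRelCodim W₁' W₂')
    (h₂' : FiniteRelCodim W₂' W₁') :
    relDim (W₁.prod W₁') (W₂.prod W₂') = relDim W₁ W₂ + relDim W₁' W₂' := by
  simp only [relDim]
  rw [relCodim_prod _ _ _ _ h₁ h₁', relCodim_prod _ _ _ _ h₂ h₂']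
  push_cast
  ring

/-- The complement `T` maps isomorphically onto `Y / X`. -/
theorem relCodim_eq_finrank_of_isCompl {X T Y : Submodule K V} (hd : Disjoint X T)
    (hs : X ⊔ T = Y) : relCodim X Y = Module.finrank K T := by
  unfold relCodim
  subst hs
  have h0 : X.map X.mkQ = ⊥ := X.mkQ_map_self
  rw [Submodule.map_sup, h0, bot_sup_eq]
  have := (nonempty_map_equiv_map X.mkQ LinearMap.id T fun y hy => by
    simp only [Submodule.mkQ_apply, Submodule.Quotient.mk_eq_zero, LinearMap.id_apply]
    exact ⟨fun h => Submodule.disjoint_def.1 hd y h hy, fun h => h ▸ X.zero_mem⟩).some.finrank_eq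
  rwa [Submodule.map_id] at this

/-- Since `φ` is injective on `X`, dividing out `X` and `φ X` changes neither kernel nor cokernel up
to isomorphism. What remains is a map of finite-dimensional spaces, whose index is the difference of
their dimensions. -/
theorem fredholm_of_restrict {W W' : Type} [AddCommGroup W] [Module K W] [AddCommGroup W']
    [Module K W'] (φ : W →ₗ[K] W') (X : Submodule K W) (hX : Disjoint X (LinearMap.ker φ))
    [FiniteDimensional K (W ⧸ X)] [FiniteDimensional K (W' ⧸ X.map φ)] :
    FredholmMap φ ∧ fredholmIndex φ =
      (Module.finrank K (W ⧸ X) : ℤ) - Module.finrank K (W' ⧸ X.map φ) := by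
  let ψ : (W ⧸ X) →ₗ[K] (W' ⧸ X.map φ) := X.mapQ (X.map φ) φ (Submodule.le_comap_map _ _)
  -- The preimage of `φ X` under `φ` is `X ⊔ ker φ`, and `X` dies in the quotient.
  have hker : LinearMap.ker ψ = (LinearMap.ker φ).map X.mkQ := by
    change LinearMap.ker (X.liftQ _ _) = _
    rw [Submodule.ker_liftQ, LinearMap.ker_comp, Submodule.ker_mkQ, Submodule.comap_map_eq,
      Submodule.map_sup]
    rw [X.mkQ_map_self, bot_sup_eq]
  have e1 : LinearMap.ker φ ≃ₗ[K] LinearMap.ker ψ := by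
    rw [hker]
    have := (nonempty_map_equiv_map LinearMap.id X.mkQ (LinearMap.ker φ) fun y hy => by
      simp only [Submodule.mkQ_apply, Submodule.Quotient.mk_eq_zero, LinearMap.id_apply]
      exact ⟨fun h => h ▸ X.zero_mem, fun h => Submodule.disjoint_def.1 hX y h hy⟩).some
    rwa [Submodule.map_id] at this
  have hrange : LinearMap.range ψ = (LinearMap.range φ).map (X.map φ).mkQ := by
    change LinearMap.range (X.liftQ _ _) = _
    rw [Submodule.range_liftQ, LinearMap.range_comp]
  have e2 : ((W' ⧸ X.map φ) ⧸ LinearMap.range ψ) ≃ₗ[K] W' ⧸ LinearMap.range φ := by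
    rw [hrange]
    exact Submodule.quotientQuotientEquivQuotient _ _ LinearMap.map_le_range
  have : FiniteDimensional K (LinearMap.ker φ) := Module.Finite.equiv e1.symm
  refine ⟨⟨this, Module.Finite.equiv e2⟩, ?_⟩
  have h1 := ψ.finrank_range_add_finrank_ker
  have h2 := (LinearMap.range ψ).finrank_quotient_add_finrank
  rw [e2.finrank_eq] at h2
  rw [← e1.finrank_eq] at h1
  unfold fredholmIndex
  omega

theorem finrank_quotient_submoduleOf (X W : Submodule K V) :
    Module.finrank K (W ⧸ X.submoduleOf W) = relCodim X W := by
  have e : (LinearMap.ker (X.mkQ.domRestrict W)) = X.submoduleOf W := by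
    ext w; simp [Submodule.submoduleOf]
  rw [relCodim, ← LinearMap.range_domRestrict, ← e]
  exact (X.mkQ.domRestrict W).quotKerEquivRange.finrank_eq

theorem FiniteRelCodim.finiteDimensional_quotient {X W : Submodule K V}
    (h : FiniteRelCodim X W) : FiniteDimensional K (W ⧸ X.submoduleOf W) := by
  have e : (LinearMap.ker (X.mkQ.domRestrict W)) = X.submoduleOf W := by
    ext w; simp [Submodule.submoduleOf]
  rw [FiniteRelCodim, ← LinearMap.range_domRestrict] at h
  rw [← e]
  exact Module.Finite.equiv (X.mkQ.domRestrict W).quotKerEquivRange.symm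

theorem FiniteRelCodim.map_equiv {X Y : Submodule K V} (h : FiniteRelCodim X Y)
    (e : V ≃ₗ[K] V') :
    FiniteRelCodim (X.map (e : V →ₗ[K] V')) (Y.map (e : V →ₗ[K] V')) := by
  rw [finiteRelCodim_iff_map ((X.map (e : V →ₗ[K] V')).mkQ ∘ₗ (e : V →ₗ[K] V')) X Y,
    Submodule.map_comp] at h
  · exact h
  · intro y _
    simp

/-- The compression of an automorphism `A` to a subspace `W` commensurable with its image has the
relative dimension of `A W` and `W` as its index. -/
theorem fredholmIndex_compression (A : V ≃ₗ[K] V) {X W : Submodule K V} (hX : X ≤ W)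
    (hX' : X ≤ W.map (A : V →ₗ[K] V)) (f : FiniteRelCodim X W)
    (f' : FiniteRelCodim X (W.map (A : V →ₗ[K] V))) {ν : V →ₗ[K] V} (hν : LinearMap.IsProj W ν) :
    FredholmMap (hν.codRestrict ∘ₗ (A : V →ₗ[K] V) ∘ₗ W.subtype) ∧
      fredholmIndex (hν.codRestrict ∘ₗ (A : V →ₗ[K] V) ∘ₗ W.subtype) =
        relDim (W.map (A : V →ₗ[K] V)) W := by
  set φ := hν.codRestrict ∘ₗ (A : V →ₗ[K] V) ∘ₗ W.subtype with hφ
  have hφv : ∀ w : W, (φ w : V) = ν (A w) := fun w => rfl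
  -- On `Y = A⁻¹ X ≤ W` the map `A` already lands in `X ≤ W`, where `ν` is the identity; so `φ`
  -- agrees with `A` on `Y` and is injective there.
  set Y : Submodule K V := X.map (A.symm : V →ₗ[K] V) with hY
  have hYA : ∀ v, v ∈ Y ↔ A v ∈ X := by
    intro v
    simp only [hY, Submodule.mem_map]
    exact ⟨by rintro ⟨x, hx, rfl⟩; simpa using hx, fun h => ⟨A v, h, by simp⟩⟩
  have hAY : Y.map (A : V →ₗ[K] V) = X := by
    ext v
    simp only [Submodule.mem_map]
    constructor
    · rintro ⟨y, hy, rfl⟩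
      exact (hYA y).1 hy
    · exact fun hv => ⟨A.symm v, (hYA _).2 (by simpa using hv), by simp⟩
  -- Apply `A⁻¹` to the pair `X ≤ A W`.
  have hYW : FiniteRelCodim Y W := by
    have := f'.map_equiv A.symm
    rwa [← Submodule.map_comp, LinearEquiv.symm_comp, Submodule.map_id] at this
  have hmap : (Y.submoduleOf W).map φ = X.submoduleOf W := by
    ext w
    simp only [Submodule.mem_map, Submodule.submoduleOf, Submodule.mem_comap,
      Submodule.subtype_apply]
    constructor
    · rintro ⟨y, hy, rfl⟩
      rw [hφv, hν.map_id _ (hX ((hYA _).1 hy))]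
      exact (hYA _).1 hy
    · intro hw
      obtain ⟨y, hy, hyw⟩ := hX' hw
      refine ⟨⟨y, hy⟩, (hYA _).2 ?_, Subtype.ext ?_⟩
      · exact (congrArg (· ∈ X) hyw).mpr hw
      · rw [hφv]
        refine (congrArg ν hyw).trans (hν.map_id _ w.2)
  have hdisj : Disjoint (Y.submoduleOf W) (LinearMap.ker φ) := by
    rw [Submodule.disjoint_def]
    intro w hw hk
    have h1 : (φ w : V) = 0 := by rw [LinearMap.mem_ker.1 hk]; rfl
    rw [hφv, hν.map_id (A (w : V)) (hX ((hYA w).1 hw))] at h1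
    exact Subtype.ext (by simpa using h1)
  have := hYW.finiteDimensional_quotient
  have : FiniteDimensional K (W ⧸ (Y.submoduleOf W).map φ) := by
    rw [hmap]; exact f.finiteDimensional_quotient
  have key := fredholm_of_restrict φ (Y.submoduleOf W) hdisj
  refine ⟨key.1, key.2.trans ?_⟩
  -- The index is `dim W / Y - dim W / X`, and `A` identifies `W / Y` with `A W / X`.
  rw [hmap, finrank_quotient_submoduleOf, finrank_quotient_submoduleOf,
    relDim_eq_sub hX' hX f' f, ← relCodim_map_equiv A Y W, hAY]

end RelativeDimension

/-! ### The filtration of `ℱ` and induced maps -/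

section Filtration

variable {Λ Λ' : QubitChain} {L : Subgroup Λ.Pauli} {S : Subgroup L} [S.Normal]
  {L' : Subgroup Λ'.Pauli} {S' : Subgroup L'} [S'.Normal]

/-- The image in `ℱ` of a class in `ℒ/𝒮`. -/
def toFSpace (g : L ⧸ S) : FSpace L S := Additive.ofMul (QuotientGroup.mk g)

theorem toFSpace_mul (g h : L ⧸ S) : toFSpace (g * h) = toFSpace g + toFSpace h := rfl

theorem toFSpace_eq_zero_iff (g : L ⧸ S) : toFSpace g = 0 ↔ g ∈ classesAtInf L S :=
  QuotientGroup.eq_one_iff g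

theorem toFSpace_mk_surjective (f : FSpace L S) : ∃ P : L, toFSpace (P : L ⧸ S) = f := by
  obtain ⟨g, hg⟩ := QuotientGroup.mk_surjective f.toMul
  obtain ⟨P, rfl⟩ := QuotientGroup.mk_surjective g
  exact ⟨P, hg⟩

theorem mem_classesOn {R : Set ℤ} {g : L ⧸ S} :
    g ∈ classesOn L S R ↔ ∃ P : L, Λ.supp P ⊆ R ∧ (P : L ⧸ S) = g := Iff.rfl

theorem classesOn_mono {R R' : Set ℤ} (h : R ⊆ R') : classesOn L S R ≤ classesOn L S R' := by
  rintro _ ⟨P, hP, rfl⟩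
  exact ⟨P, hP.trans h, rfl⟩

/-- Classes at `+∞` vanish in `ℱ`, so the factor from `classesAtPosInf` can be dropped from a
representative. -/
theorem mem_FBelow {a : ℤ} {f : FSpace L S} :
    f ∈ FBelow L S a ↔ ∃ P : L, Λ.supp P ⊆ Set.Iio a ∧ toFSpace (P : L ⧸ S) = f := by
  constructor
  · rintro ⟨g, hg, rfl⟩
    obtain ⟨x, ⟨P, hP, rfl⟩, y, hy, rfl⟩ := Subgroup.mem_sup_of_normal_left.1 hg
    refine ⟨P, hP, ?_⟩
    change toFSpace _ = toFSpace _
    have : toFSpace y = 0 := (toFSpace_eq_zero_iff y).2 (Subgroup.mem_sup_right hy)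
    rw [toFSpace_mul, this, add_zero]
    rfl
  · rintro ⟨P, hP, rfl⟩
    exact ⟨P, Subgroup.mem_sup_left ⟨P, hP, rfl⟩, rfl⟩

theorem FBelow_mono {a b : ℤ} (h : a ≤ b) : FBelow L S a ≤ FBelow L S b := by
  intro f hf
  obtain ⟨P, hP, rfl⟩ := mem_FBelow.1 hf
  exact mem_FBelow.2 ⟨P, hP.trans (Set.Iio_subset_Iio h), rfl⟩

/-- Two Paulis supported left of `b` that have the same bits on the finitely many qubits in `[a, b)`
differ by one supported left of `a`. The quotient therefore injects into the bit patterns on `[a,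
b)` and is even a finite set. -/
theorem finiteRelCodim_FBelow (a b : ℤ) : FiniteRelCodim (FBelow L S a) (FBelow L S b) := by
  have hfin : (Λ.site ⁻¹' Set.Ico a b).Finite :=
    (Set.finite_Ico a b).preimage' fun k _ => Λ.finite_site k
  have : Finite (Λ.site ⁻¹' Set.Ico a b) := hfin
  have hP : ∀ v : (FBelow L S b).map (FBelow L S a).mkQ, ∃ P : L, Λ.supp P ⊆ Set.Iio b ∧
      (FBelow L S a).mkQ (toFSpace (P : L ⧸ S)) = v := by
    rintro ⟨v, f, hf, rfl⟩
    obtain ⟨P, hP, rfl⟩ := mem_FBelow.1 hf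
    exact ⟨P, hP, rfl⟩
  choose P hPs hPv using hP
  have : Finite ((FBelow L S b).map (FBelow L S a).mkQ) := by
    refine Finite.of_injective (β := (Λ.site ⁻¹' Set.Ico a b) → ZMod 2 × ZMod 2)
      (fun v j => ((P v : Λ.Pauli).x j, (P v : Λ.Pauli).z j)) fun v w h => ?_
    refine Subtype.ext ?_
    rw [← hPv, ← hPv, ← sub_eq_zero, ← map_sub, Submodule.mkQ_apply,
      Submodule.Quotient.mk_eq_zero]
    refine mem_FBelow.2 ⟨P v * (P w)⁻¹, ?_, ?_⟩
    · rintro k ⟨j, rfl, hj⟩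
      by_contra hk
      have hbits : ∀ j, Λ.site j ∈ Set.Ico a b →
          (P v : Λ.Pauli).x j = (P w : Λ.Pauli).x j ∧
          (P v : Λ.Pauli).z j = (P w : Λ.Pauli).z j := fun j hj => by
        have := congrFun h ⟨j, hj⟩
        exact Prod.ext_iff.1 this
      have hout : ∀ v, ¬ Λ.site j < b → (P v : Λ.Pauli).x j = 0 ∧ (P v : Λ.Pauli).z j = 0 := by
        intro v hb
        by_contra hne
        refine hb (hPs v ⟨j, rfl, ?_⟩)
        tauto
      have heq : (P v : Λ.Pauli).x j = (P w : Λ.Pauli).x j ∧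
          (P v : Λ.Pauli).z j = (P w : Λ.Pauli).z j := by
        -- At a site of at least `a`, either the bits agree by assumption or, from `b` on, both
        -- operators act trivially.
        by_cases hb : Λ.site j < b
        · exact hbits j ⟨not_lt.1 hk, hb⟩
        · rw [(hout v hb).1, (hout v hb).2, (hout w hb).1, (hout w hb).2]
          exact ⟨rfl, rfl⟩
      simp [heq.1, heq.2, CharTwo.add_self_eq_zero] at hj
    · rfl
  exact Module.Finite.of_finite

/-- A subspace of `ℱ` that lies between two subspaces `ℱ_{<a}`, `ℱ_{<b}`. -/
def IsCut (W : Submodule (ZMod 2) (FSpace L S)) : Prop :=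
  ∃ a b, FBelow L S a ≤ W ∧ W ≤ FBelow L S b

theorem isCut_FBelow (a : ℤ) : IsCut (FBelow L S a) := ⟨a, a, le_rfl, le_rfl⟩

/-- A sufficiently low `ℱ_{<a}` serves as the common subspace from which relative dimensions of cuts
are measured. -/
theorem IsCut.exists_common {W₁ W₂ W₃ : Submodule (ZMod 2) (FSpace L S)} (h₁ : IsCut W₁)
    (h₂ : IsCut W₂) (h₃ : IsCut W₃) : ∃ X, (X ≤ W₁ ∧ X ≤ W₂ ∧ X ≤ W₃) ∧
      FiniteRelCodim X W₁ ∧ FiniteRelCodim X W₂ ∧ FiniteRelCodim X W₃ := by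
  obtain ⟨a₁, b₁, ha₁, hb₁⟩ := h₁
  obtain ⟨a₂, b₂, ha₂, hb₂⟩ := h₂
  obtain ⟨a₃, b₃, ha₃, hb₃⟩ := h₃
  refine ⟨FBelow L S (min a₁ (min a₂ a₃)), ⟨(FBelow_mono (by simp)).trans ha₁,
    (FBelow_mono (by simp)).trans ha₂, (FBelow_mono (by simp)).trans ha₃⟩,
    (finiteRelCodim_FBelow _ _).mono le_rfl hb₁, (finiteRelCodim_FBelow _ _).mono le_rfl hb₂,
    (finiteRelCodim_FBelow _ _).mono le_rfl hb₃⟩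

theorem IsCut.relDim_add {W₁ W₂ W₃ : Submodule (ZMod 2) (FSpace L S)} (h₁ : IsCut W₁)
    (h₂ : IsCut W₂) (h₃ : IsCut W₃) : relDim W₁ W₂ + relDim W₂ W₃ = relDim W₁ W₃ := by
  obtain ⟨X, ⟨i₁, i₂, i₃⟩, f₁, f₂, f₃⟩ := h₁.exists_common h₂ h₃
  exact _root_.relDim_add i₁ i₂ i₃ f₁ f₂ f₃

theorem IsCut.finiteRelCodim {W₁ W₂ : Submodule (ZMod 2) (FSpace L S)} (h₁ : IsCut W₁)
    (h₂ : IsCut W₂) : FiniteRelCodim W₁ W₂ := by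
  obtain ⟨X, ⟨i₁, -, -⟩, -, f₂, -⟩ := h₁.exists_common h₂ h₂
  exact f₂.mono i₁ le_rfl

/-! ### Locality-preserving maps on `ℱ` -/

theorem nbhd_subset_Iio {r : ℕ} {a : ℤ} {R : Set ℤ} (h : R ⊆ Set.Iio a) :
    nbhd r R ⊆ Set.Iio (a + r) := by
  rintro k ⟨i, hi, hk⟩
  have h1 := h hi
  have h2 := (abs_le.1 hk).2
  simp only [Set.mem_Iio] at h1 ⊢
  linarith

theorem nbhd_subset_Ioi {r : ℕ} {a : ℤ} {R : Set ℤ} (h : R ⊆ Set.Ioi a) :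
    nbhd r R ⊆ Set.Ioi (a - r) := by
  rintro k ⟨i, hi, hk⟩
  have h1 := h hi
  have h2 := (abs_le.1 hk).1
  simp only [Set.mem_Ioi] at h1 ⊢
  linarith

/-- Supports grow by at most `r`, so a class with representatives arbitrarily far out has an image
of the same kind: a bound `k` for the image needs only the bound `k ∓ r` for the class. -/
theorem LocalityPreserving.classesAtInf_le_comap {U : L ⧸ S →* L' ⧸ S'}
    (hU : LocalityPreserving U) : classesAtInf L S ≤ (classesAtInf L' S').comap U := by
  obtain ⟨r, hr⟩ := hU
  refine sup_le (fun f hf => Subgroup.mem_sup_left (Subgroup.mem_iInf.2 fun k => ?_))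
    (fun f hf => Subgroup.mem_sup_right (Subgroup.mem_iInf.2 fun k => ?_))
  · obtain ⟨P, hP, rfl⟩ := Subgroup.mem_iInf.1 hf (k - r)
    obtain ⟨Q, hQ, hQs⟩ := hr P
    refine ⟨Q, ?_, hQ.symm⟩
    have := hQs.trans (nbhd_subset_Iio hP)
    rwa [sub_add_cancel] at this
  · obtain ⟨P, hP, rfl⟩ := Subgroup.mem_iInf.1 hf (k + r)
    obtain ⟨Q, hQ, hQs⟩ := hr P
    refine ⟨Q, ?_, hQ.symm⟩
    have := hQs.trans (nbhd_subset_Ioi hP)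
    rwa [add_sub_cancel_right] at this

/-- The linear map of `ℱ`-spaces induced by a locality-preserving homomorphism. -/
def LocalityPreserving.fMap {U : L ⧸ S →* L' ⧸ S'} (hU : LocalityPreserving U) :
    FSpace L S →ₗ[ZMod 2] FSpace L' S' :=
  AddMonoidHom.toZModLinearMap 2 (MonoidHom.toAdditive
    (QuotientGroup.map (classesAtInf L S) (classesAtInf L' S') U hU.classesAtInf_le_comap))

theorem LocalityPreserving.fMap_toFSpace {U : L ⧸ S →* L' ⧸ S'} (hU : LocalityPreserving U)
    (g : L ⧸ S) : hU.fMap (toFSpace g) = toFSpace (U g) := rfl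

theorem LocalityPreserving.exists_map_FBelow_le {U : L ⧸ S →* L' ⧸ S'}
    (hU : LocalityPreserving U) :
    ∃ r : ℕ, ∀ a, (FBelow L S a).map hU.fMap ≤ FBelow L' S' (a + r) := by
  have ⟨r, hr⟩ := hU
  refine ⟨r, fun a => ?_⟩
  rintro _ ⟨f, hf, rfl⟩
  obtain ⟨P, hP, rfl⟩ := mem_FBelow.1 hf
  obtain ⟨Q, hQ, hQs⟩ := hr P
  exact mem_FBelow.2 ⟨Q, hQs.trans (nbhd_subset_Iio hP), by rw [hU.fMap_toFSpace, hQ]⟩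

theorem linearMap_ext_toFSpace {W : Type} [AddCommGroup W] [Module (ZMod 2) W]
    {f g : FSpace L S →ₗ[ZMod 2] W} (h : ∀ P : L, f (toFSpace (P : L ⧸ S)) = g (toFSpace P)) :
    f = g := by
  ext v
  obtain ⟨P, rfl⟩ := toFSpace_mk_surjective v
  exact h P

/-- The isomorphism of `ℱ`-spaces induced by a locality-preserving isomorphism. -/
def LocalityPreservingIso.fEquiv {U : L ⧸ S ≃* L' ⧸ S'} (hU : LocalityPreservingIso U) :
    FSpace L S ≃ₗ[ZMod 2] FSpace L' S' :=
  LinearEquiv.ofLinearMap hU.1.fMap hU.2.fMap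
    (linearMap_ext_toFSpace fun _ => congrArg toFSpace (U.apply_symm_apply _))
    (linearMap_ext_toFSpace fun _ => congrArg toFSpace (U.symm_apply_apply _))

theorem LocalityPreservingIso.isCut_map {U : L ⧸ S ≃* L' ⧸ S'} (hU : LocalityPreservingIso U)
    {W : Submodule (ZMod 2) (FSpace L S)} (hW : IsCut W) :
    IsCut (W.map (hU.fEquiv : FSpace L S →ₗ[ZMod 2] FSpace L' S')) := by
  obtain ⟨a, b, ha, hb⟩ := hW
  obtain ⟨r, hr⟩ := hU.1.exists_map_FBelow_le
  obtain ⟨s, hs⟩ := hU.2.exists_map_FBelow_le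
  -- Locality of `U` gives the upper bound; the lower one comes from its inverse, which maps
  -- `ℱ_{<a-s}` into `ℱ_{<a}`.
  refine ⟨a - s, b + r, fun f hf => ?_, (Submodule.map_mono hb).trans (hr b)⟩
  refine ⟨hU.2.fMap f, ha ?_, hU.fEquiv.apply_symm_apply f⟩
  have := hs (a - s) ⟨f, hf, rfl⟩
  rwa [sub_add_cancel] at this

/-- The automorphism of `ℱ` induced by an MQCA. -/
def inducedEquiv (α : MQCA L S) : FSpace L S ≃ₗ[ZMod 2] FSpace L S :=
  LocalityPreservingIso.fEquiv α.2

theorem inducedEquiv_toFSpace (α : MQCA L S) (g : L ⧸ S) :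
    inducedEquiv α (toFSpace g) = toFSpace ((α : MulAut (L ⧸ S)) g) := rfl

theorem isCut_map_inducedEquiv (α : MQCA L S) {W : Submodule (ZMod 2) (FSpace L S)}
    (hW : IsCut W) : IsCut (W.map (inducedEquiv α : FSpace L S →ₗ[ZMod 2] FSpace L S)) :=
  LocalityPreservingIso.isCut_map α.2 hW

/-! ### The index as a relative dimension -/

theorem cutMap_index (α : MQCA L S) {W : Submodule (ZMod 2) (FSpace L S)} (hW : IsCut W)
    {ν : FSpace L S →ₗ[ZMod 2] FSpace L S} (hν : LinearMap.IsProj W ν) :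
    FredholmMap (cutMap α W ν hν) ∧ fredholmIndex (cutMap α W ν hν) =
      relDim (W.map (inducedEquiv α : FSpace L S →ₗ[ZMod 2] FSpace L S)) W := by
  obtain ⟨X, ⟨i₁, i₂, -⟩, f₁, f₂, -⟩ := hW.exists_common (isCut_map_inducedEquiv α hW) hW
  exact fredholmIndex_compression (inducedEquiv α) i₁ i₂ f₁ f₂ hν

/-- By additivity `[ᾱW : W] = [ᾱW : ᾱW'] + [ᾱW' : W'] + [W' : W]`, and the outer terms cancel
because `ᾱ` preserves relative dimension. -/
theorem relDim_map_inducedEquiv_eq (α : MQCA L S) {W W' : Submodule (ZMod 2) (FSpace L S)}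
    (hW : IsCut W) (hW' : IsCut W') :
    relDim (W.map (inducedEquiv α : FSpace L S →ₗ[ZMod 2] FSpace L S)) W =
      relDim (W'.map (inducedEquiv α : FSpace L S →ₗ[ZMod 2] FSpace L S)) W' := by
  have h1 := (isCut_map_inducedEquiv α hW).relDim_add (isCut_map_inducedEquiv α hW') hW'
  have h2 := (isCut_map_inducedEquiv α hW).relDim_add hW hW'
  have h3 := relDim_map_equiv (inducedEquiv α) W W'
  linarith

theorem Ind_eq_relDim (α : MQCA L S) {W : Submodule (ZMod 2) (FSpace L S)} (hW : IsCut W) :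
    Ind α = (1 / 2 : ℚ) *
      relDim (W.map (inducedEquiv α : FSpace L S →ₗ[ZMod 2] FSpace L S)) W := by
  rw [Ind, (cutMap_index α (isCut_FBelow 0) _).2,
    relDim_map_inducedEquiv_eq α (isCut_FBelow 0) hW]

theorem Ind_well_defined (α : MQCA L S) {a b : ℤ} {F₀ : Submodule (ZMod 2) (FSpace L S)}
    {ν : FSpace L S →ₗ[ZMod 2] FSpace L S} (hν : LinearMap.IsProj F₀ ν)
    (ha : FBelow L S a ≤ F₀) (hb : F₀ ≤ FBelow L S b) :
    FredholmMap (cutMap α F₀ ν hν) ∧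
      Ind α = (1 / 2 : ℚ) * fredholmIndex (cutMap α F₀ ν hν) := by
  have hW : IsCut F₀ := ⟨a, b, ha, hb⟩
  obtain ⟨h1, h2⟩ := cutMap_index α hW hν
  exact ⟨h1, by rw [h2, Ind_eq_relDim α hW]⟩

theorem Ind_mul (α β : MQCA L S) : Ind (α * β) = Ind α + Ind β := by
  have hW := isCut_FBelow (L := L) (S := S) 0
  have hβ := isCut_map_inducedEquiv β hW
  have e : (FBelow L S 0).map (inducedEquiv (α * β) : FSpace L S →ₗ[ZMod 2] FSpace L S) =
      ((FBelow L S 0).map (inducedEquiv β : FSpace L S →ₗ[ZMod 2] FSpace L S)).map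
        (inducedEquiv α : FSpace L S →ₗ[ZMod 2] FSpace L S) := by
    rw [← Submodule.map_comp]
    exact congrArg (fun f => (FBelow L S 0).map f) (linearMap_ext_toFSpace fun _ => rfl)
  -- Independence of the cut permits computing `Ind α` at `β̄W`; then `[ᾱβ̄W : W] = [ᾱβ̄W : β̄W] +
  -- [β̄W : W]`.
  rw [Ind_eq_relDim (α * β) hW, Ind_eq_relDim α hβ, Ind_eq_relDim β hW, e,
    ← (isCut_map_inducedEquiv α hβ).relDim_add hβ hW]
  push_cast
  ring

theorem Ind_one : Ind (1 : MQCA L S) = 0 := by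
  have := Ind_mul (1 : MQCA L S) 1
  rw [mul_one] at this
  linarith

theorem Ind_inv (α : MQCA L S) : Ind α⁻¹ = -Ind α := by
  have := Ind_mul α⁻¹ α
  rw [inv_mul_cancel, Ind_one] at this
  linarith

theorem LocalityPreserving.comp {Λ'' : QubitChain} {L'' : Subgroup Λ''.Pauli}
    {S'' : Subgroup L''} [S''.Normal] {U : L' ⧸ S' →* L'' ⧸ S''} {U' : L ⧸ S →* L' ⧸ S'}
    (hU : LocalityPreserving U) (hU' : LocalityPreserving U') :
    LocalityPreserving (U.comp U') := by
  obtain ⟨r, hr⟩ := hU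
  obtain ⟨s, hs⟩ := hU'
  refine ⟨r + s, fun P => ?_⟩
  obtain ⟨Q, hQ, hQs⟩ := hs P
  obtain ⟨T, hT, hTs⟩ := hr Q
  exact ⟨T, by rw [MonoidHom.comp_apply, hQ, hT],
    hTs.trans ((nbhd_mono hQs).trans (nbhd_nbhd r s _))⟩

theorem LocalityPreservingIso.conj_mem {U : L ⧸ S ≃* L' ⧸ S'} (hU : LocalityPreservingIso U)
    (α : MQCA L S) : U.symm.trans ((α : MulAut (L ⧸ S)).trans U) ∈ MQCA L' S' :=
  ⟨(hU.1.comp α.2.1).comp hU.2, (hU.1.comp α.2.2).comp hU.2⟩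

/-- The isomorphism induced by `U` carries the pair `(ᾱW, W)` to the pair that belongs to the
conjugate and the cut `U W`. -/
theorem Ind_conj {U : L ⧸ S ≃* L' ⧸ S'} (hU : LocalityPreservingIso U) (α : MQCA L S) :
    Ind (⟨_, hU.conj_mem α⟩ : MQCA L' S') = Ind α := by
  have hW := isCut_FBelow (L := L) (S := S) 0
  rw [Ind_eq_relDim α hW, Ind_eq_relDim _ (hU.isCut_map hW),
    ← relDim_map_equiv hU.fEquiv _ (FBelow L S 0)]
  congr 3
  rw [← Submodule.map_comp, ← Submodule.map_comp]
  congr 1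
  refine linearMap_ext_toFSpace fun P => ?_
  change toFSpace (U ((α : MulAut (L ⧸ S)) (U.symm (U P)))) = toFSpace (U _)
  rw [U.symm_apply_apply]
  rfl

end Filtration

/-! ### Double layers -/

namespace PauliOp

variable {N : Type}

theorem mul_scalar (p : PauliOp N) (c : ZMod 4) : p * scalar c = ⟨p.phase + c, p.x, p.z⟩ := by
  ext1 <;> simp [scalar, bitDot_zero_right]

theorem scalar_mul (p : PauliOp N) (c : ZMod 4) : scalar c * p = ⟨c + p.phase, p.x, p.z⟩ := by
  ext1 <;> simp [scalar, bitDot_zero_left]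

end PauliOp

section Tensor

variable {Λ₁ Λ₂ : QubitChain}

/-- The bits of both factors can be read off from `P ⊗ Q`, whereas the phases are only known through
their sum; the ambiguity is a scalar moved between the factors. -/
theorem pauliTensor_eq_iff {p p' : Λ₁.Pauli} {q q' : Λ₂.Pauli} :
    pauliTensor Λ₁ Λ₂ (p, q) = pauliTensor Λ₁ Λ₂ (p', q') ↔
      ∃ c, p = p' * PauliOp.scalar c ∧ q * PauliOp.scalar c = q' := by
  constructor
  · intro h
    have hx : bitSum p.x q.x = bitSum p'.x q'.x := congrArg PauliOp.x h
    have hz : bitSum p.z q.z = bitSum p'.z q'.z := congrArg PauliOp.z h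
    have hp : p.phase + q.phase = p'.phase + q'.phase := congrArg PauliOp.phase h
    refine ⟨p.phase - p'.phase, ?_, ?_⟩
    · rw [PauliOp.mul_scalar]
      refine PauliOp.ext (by ring) ?_ ?_ <;> ext j
      · simpa [bitSum] using DFunLike.congr_fun hx (Sum.inl j)
      · simpa [bitSum] using DFunLike.congr_fun hz (Sum.inl j)
    · rw [PauliOp.mul_scalar]
      refine PauliOp.ext (by linear_combination hp) ?_ ?_ <;> ext j
      · simpa [bitSum] using DFunLike.congr_fun hx (Sum.inr j)
      · simpa [bitSum] using DFunLike.congr_fun hz (Sum.inr j)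
  · rintro ⟨c, rfl, rfl⟩
    rw [PauliOp.mul_scalar, PauliOp.mul_scalar]
    refine PauliOp.ext ?_ rfl rfl
    change p'.phase + c + q.phase = p'.phase + (q.phase + c)
    ring

theorem supp_pauliTensor (p : Λ₁.Pauli) (q : Λ₂.Pauli) :
    (Λ₁.stack Λ₂).supp (pauliTensor Λ₁ Λ₂ (p, q)) = Λ₁.supp p ∪ Λ₂.supp q := by
  ext k
  constructor
  · rintro ⟨j | j, hj, h⟩
    · exact Or.inl ⟨j, hj, h⟩
    · exact Or.inr ⟨j, hj, h⟩
  · rintro (⟨j, hj, h⟩ | ⟨j, hj, h⟩)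
    · exact ⟨Sum.inl j, hj, h⟩
    · exact ⟨Sum.inr j, hj, h⟩

theorem supp_one (Λ : QubitChain) : Λ.supp 1 = ∅ := by
  ext k
  simp [QubitChain.supp]

theorem supp_scalar (Λ : QubitChain) (c : ZMod 4) : Λ.supp (PauliOp.scalar c) = ∅ := by
  ext k
  simp [QubitChain.supp, PauliOp.scalar]

/-! ### The map `([P], [Q]) ↦ [P ⊗ Q]` and its kernel -/

variable {L₁ : Subgroup Λ₁.Pauli} {S₁ : Subgroup L₁} [S₁.Normal]
  {L₂ : Subgroup Λ₂.Pauli} {S₂ : Subgroup L₂} [S₂.Normal]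

theorem tensorElt_mul (P P' : L₁) (Q Q' : L₂) :
    tensorElt (P * P') (Q * Q') = tensorElt P Q * tensorElt P' Q' :=
  Subtype.ext (map_mul (pauliTensor Λ₁ Λ₂) ((P : Λ₁.Pauli), (Q : Λ₂.Pauli))
    ((P' : Λ₁.Pauli), (Q' : Λ₂.Pauli)))

theorem tensorElt_surjective (T : tensorGroup L₁ L₂) : ∃ P Q, tensorElt P Q = T := by
  obtain ⟨_, ⟨p, q⟩, ⟨hp, hq⟩, rfl⟩ := T
  exact ⟨⟨p, hp⟩, ⟨q, hq⟩, rfl⟩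

variable (L₁ L₂) in
/-- The homomorphism `(P, Q) ↦ P ⊗ Q` into `L₁ ⊗ L₂`. -/
def tensorHom : L₁ × L₂ →* tensorGroup L₁ L₂ :=
  MonoidHom.mk' (fun p => tensorElt p.1 p.2) fun p q => tensorElt_mul p.1 q.1 p.2 q.2

variable (S₁ S₂)

/-- The homomorphism `[P] ↦ [P ⊗ 1]`. -/
def tensorLeft : L₁ ⧸ S₁ →* tensorGroup L₁ L₂ ⧸ tensorSubgroup S₁ S₂ :=
  QuotientGroup.map S₁ _ ((tensorHom L₁ L₂).comp (MonoidHom.inl L₁ L₂)) fun P hP =>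
    ⟨P, hP, 1, one_mem _, rfl⟩

/-- The homomorphism `[Q] ↦ [1 ⊗ Q]`. -/
def tensorRight : L₂ ⧸ S₂ →* tensorGroup L₁ L₂ ⧸ tensorSubgroup S₁ S₂ :=
  QuotientGroup.map S₂ _ ((tensorHom L₁ L₂).comp (MonoidHom.inr L₁ L₂)) fun Q hQ =>
    ⟨1, one_mem _, Q, hQ, rfl⟩

/-- The homomorphism `([P], [Q]) ↦ [P ⊗ Q]`. -/
def tensorClass :
    (L₁ ⧸ S₁) × (L₂ ⧸ S₂) →* tensorGroup L₁ L₂ ⧸ tensorSubgroup S₁ S₂ :=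
  (tensorLeft S₁ S₂).noncommCoprod (tensorRight S₁ S₂) fun g h => by
    induction g using QuotientGroup.induction_on with | _ P
    induction h using QuotientGroup.induction_on with | _ Q
    change (QuotientGroup.mk (tensorElt P 1 * tensorElt 1 Q) :
      tensorGroup L₁ L₂ ⧸ tensorSubgroup S₁ S₂) = QuotientGroup.mk (tensorElt 1 Q * tensorElt P 1)
    rw [← tensorElt_mul, ← tensorElt_mul]
    simp

variable {S₁ S₂}

theorem tensorClass_mk (P : L₁) (Q : L₂) :
    tensorClass S₁ S₂ (P, Q) = QuotientGroup.mk (tensorElt P Q) := by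
  change (QuotientGroup.mk (tensorElt P 1 * tensorElt 1 Q) :
      tensorGroup L₁ L₂ ⧸ tensorSubgroup S₁ S₂) = _
  rw [← tensorElt_mul]
  simp

theorem tensorClass_surjective : Function.Surjective (tensorClass S₁ S₂) := by
  intro t
  induction t using QuotientGroup.induction_on with | _ T
  obtain ⟨P, Q, rfl⟩ := tensorElt_surjective T
  exact ⟨_, tensorClass_mk P Q⟩

/-- After correcting by `s ⊗ t` with `s ∈ S₁`, `t ∈ S₂`, the operators are equal and differ only by
a scalar moved between the factors. This scalar is a quotient of elements of `L₁` and also of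
elements of `L₂`, so it lies in both groups. -/
theorem mk_tensorElt_eq {P P' : L₁} {Q Q' : L₂}
    (h : (QuotientGroup.mk (tensorElt P Q) : tensorGroup L₁ L₂ ⧸ tensorSubgroup S₁ S₂) =
      QuotientGroup.mk (tensorElt P' Q')) :
    ∃ (c : ZMod 4) (h₁ : PauliOp.scalar c ∈ L₁) (h₂ : PauliOp.scalar c ∈ L₂),
      (P : L₁ ⧸ S₁) = QuotientGroup.mk (P' * ⟨_, h₁⟩) ∧
      (QuotientGroup.mk (Q * ⟨_, h₂⟩) : L₂ ⧸ S₂) = Q' := by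
  obtain ⟨s, hs, t, ht, hst⟩ := QuotientGroup.eq.1 h.symm
  have h1 : tensorElt P Q = tensorElt (P' * s) (Q' * t) := by
    rw [tensorElt_mul, ← hst, mul_inv_cancel_left]
  obtain ⟨c, hc₁, hc₂⟩ := pauliTensor_eq_iff.1 (congrArg Subtype.val h1)
  have h₁ : PauliOp.scalar c ∈ L₁ := by
    have : PauliOp.scalar c = (((P' * s)⁻¹ * P : L₁) : Λ₁.Pauli) := by
      rw [Subgroup.coe_mul, hc₁, Subgroup.coe_inv, inv_mul_cancel_left]
    rw [this]
    exact Subtype.property _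
  have h₂ : PauliOp.scalar c ∈ L₂ := by
    have : PauliOp.scalar c = ((Q⁻¹ * (Q' * t) : L₂) : Λ₂.Pauli) := by
      rw [Subgroup.coe_mul, ← hc₂, Subgroup.coe_inv, inv_mul_cancel_left]
    rw [this]
    exact Subtype.property _
  have e₁ : P = P' * s * ⟨_, h₁⟩ := Subtype.ext hc₁
  have e₂ : Q * ⟨_, h₂⟩ = Q' * t := Subtype.ext hc₂
  refine ⟨c, h₁, h₂, ?_, ?_⟩
  · rw [e₁, QuotientGroup.mk_mul, QuotientGroup.mk_mul, QuotientGroup.mk_mul,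
      (QuotientGroup.eq_one_iff s).2 hs, mul_one]
  · rw [e₂, QuotientGroup.mk_mul, (QuotientGroup.eq_one_iff t).2 ht, mul_one]

/-- Comparison of `P ⊗ Q` with `1 ⊗ 1`. This kernel is the only obstruction to defining `α ⊗ β`, and
the reason for the condition `AgreeOnScalars`. -/
theorem mem_ker_tensorClass {g : L₁ ⧸ S₁} {h : L₂ ⧸ S₂} :
    (g, h) ∈ (tensorClass S₁ S₂).ker ↔
      ∃ (c : ZMod 4) (h₁ : PauliOp.scalar c ∈ L₁) (h₂ : PauliOp.scalar c ∈ L₂),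
        g = QuotientGroup.mk ⟨_, h₁⟩ ∧ h = (QuotientGroup.mk ⟨_, h₂⟩)⁻¹ := by
  constructor
  · intro H
    induction g using QuotientGroup.induction_on with | _ P
    induction h using QuotientGroup.induction_on with | _ Q
    rw [MonoidHom.mem_ker, tensorClass_mk, ← map_one (tensorClass S₁ S₂)] at H
    obtain ⟨c, h₁, h₂, e₁, e₂⟩ := mk_tensorElt_eq (H.trans (tensorClass_mk 1 1))
    refine ⟨c, h₁, h₂, by rw [e₁, one_mul], ?_⟩
    rw [eq_inv_iff_mul_eq_one]
    exact e₂
  · rintro ⟨c, h₁, h₂, rfl, rfl⟩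
    rw [MonoidHom.mem_ker, ← QuotientGroup.mk_inv, tensorClass_mk, QuotientGroup.eq_one_iff]
    refine ⟨1, one_mem _, 1, one_mem _, Subtype.ext (pauliTensor_eq_iff.2 ⟨c, ?_, ?_⟩)⟩
    · exact (one_mul _).symm
    · exact inv_mul_cancel (PauliOp.scalar c : Λ₂.Pauli)

/-- An element of the kernel is determined by an exponent in `ZMod 4`. -/
theorem finite_ker_tensorClass : Finite (tensorClass S₁ S₂).ker := by
  have h : ∀ t : (tensorClass S₁ S₂).ker, ∃ (c : ZMod 4) (h₁ : PauliOp.scalar c ∈ L₁)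
      (h₂ : PauliOp.scalar c ∈ L₂),
        (t : (L₁ ⧸ S₁) × (L₂ ⧸ S₂)) =
          (QuotientGroup.mk ⟨_, h₁⟩, (QuotientGroup.mk ⟨_, h₂⟩)⁻¹) := by
    rintro ⟨⟨g, h⟩, hgh⟩
    obtain ⟨c, h₁, h₂, rfl, rfl⟩ := mem_ker_tensorClass.1 hgh
    exact ⟨c, h₁, h₂, rfl⟩
  choose c h₁ h₂ hc using h
  refine Finite.of_injective c fun t t' htt => Subtype.ext ?_
  rw [hc t, hc t']
  simp only [htt]

theorem isTensor_iff {α : MQCA L₁ S₁} {β : MQCA L₂ S₂}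
    {γ : MQCA (tensorGroup L₁ L₂) (tensorSubgroup S₁ S₂)} :
    IsTensor α β γ ↔ ∀ g h,
      (γ : MulAut (tensorGroup L₁ L₂ ⧸ tensorSubgroup S₁ S₂)) (tensorClass S₁ S₂ (g, h)) =
        tensorClass S₁ S₂ ((α : MulAut (L₁ ⧸ S₁)) g, (β : MulAut (L₂ ⧸ S₂)) h) := by
  constructor
  · intro H g h
    induction g using QuotientGroup.induction_on with | _ P
    induction h using QuotientGroup.induction_on with | _ Q
    obtain ⟨P', hP'⟩ := QuotientGroup.mk_surjective ((α : MulAut (L₁ ⧸ S₁)) P)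
    obtain ⟨Q', hQ'⟩ := QuotientGroup.mk_surjective ((β : MulAut (L₂ ⧸ S₂)) Q)
    rw [tensorClass_mk, H P P' Q Q' hP'.symm hQ'.symm, ← hP', ← hQ', tensorClass_mk]
  · intro H P P' Q Q' hP hQ
    rw [← tensorClass_mk, H, hP, hQ, tensorClass_mk]

/-- If `α ⊗ β` exists, `α × β` maps the kernel of `tensorClass` into itself; applied to `([i^c],
[i^c]⁻¹)` this yields the scalar `i^c'`. -/
theorem IsTensor.agreeOnScalars {α : MQCA L₁ S₁} {β : MQCA L₂ S₂}
    {γ : MQCA (tensorGroup L₁ L₂) (tensorSubgroup S₁ S₂)} (H : IsTensor α β γ) :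
    AgreeOnScalars α β := by
  intro c h₁ h₂
  rw [isTensor_iff] at H
  have hker : ((QuotientGroup.mk ⟨_, h₁⟩ : L₁ ⧸ S₁), (QuotientGroup.mk ⟨_, h₂⟩ : L₂ ⧸ S₂)⁻¹) ∈
      (tensorClass S₁ S₂).ker := mem_ker_tensorClass.2 ⟨c, h₁, h₂, rfl, rfl⟩
  have h := H (QuotientGroup.mk ⟨_, h₁⟩) (QuotientGroup.mk ⟨_, h₂⟩)⁻¹
  rw [MonoidHom.mem_ker.1 hker, map_one] at h
  obtain ⟨c', h₁', h₂', e₁, e₂⟩ := mem_ker_tensorClass.1 (MonoidHom.mem_ker.2 h.symm)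
  refine ⟨c', h₁', h₂', e₁, ?_⟩
  rwa [map_inv, inv_inj] at e₂

theorem LocalityPreserving.of_tensorClass {a : L₁ ⧸ S₁ →* L₁ ⧸ S₁} {b : L₂ ⧸ S₂ →* L₂ ⧸ S₂}
    (ha : LocalityPreserving a) (hb : LocalityPreserving b)
    {c : tensorGroup L₁ L₂ ⧸ tensorSubgroup S₁ S₂ →* tensorGroup L₁ L₂ ⧸ tensorSubgroup S₁ S₂}
    (hc : ∀ g h, c (tensorClass S₁ S₂ (g, h)) = tensorClass S₁ S₂ (a g, b h)) :
    LocalityPreserving c := by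
  obtain ⟨r, hr⟩ := ha
  obtain ⟨s, hs⟩ := hb
  have mono : ∀ {r s : ℕ} (_ : r ≤ s) {R R' : Set ℤ} (_ : R ⊆ R'), nbhd r R ⊆ nbhd s R' := by
    rintro r s h R R' hR k ⟨i, hi, hk⟩
    exact ⟨i, hR hi, hk.trans (by exact_mod_cast h)⟩
  refine ⟨max r s, fun T => ?_⟩
  obtain ⟨P, Q, rfl⟩ := tensorElt_surjective T
  obtain ⟨P', hP', hPs⟩ := hr P
  obtain ⟨Q', hQ', hQs⟩ := hs Q
  refine ⟨tensorElt P' Q', ?_, ?_⟩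
  · rw [← tensorClass_mk, hc, hP', hQ', tensorClass_mk]
  · change (Λ₁.stack Λ₂).supp (pauliTensor Λ₁ Λ₂ (P', Q')) ⊆
      nbhd _ ((Λ₁.stack Λ₂).supp (pauliTensor Λ₁ Λ₂ (P, Q)))
    rw [supp_pauliTensor, supp_pauliTensor]
    exact Set.union_subset (hPs.trans (mono (le_max_left _ _) Set.subset_union_left))
      (hQs.trans (mono (le_max_right _ _) Set.subset_union_right))

/-- Agreement on scalars gives one inclusion; an injective map of a finite group into itself is
onto. Equality is what makes `α × β` descend to an isomorphism. -/
theorem AgreeOnScalars.map_ker {α : MQCA L₁ S₁} {β : MQCA L₂ S₂} (H : AgreeOnScalars α β) :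
    (tensorClass S₁ S₂).ker.map
      ((MulEquiv.prodCongr (α : MulAut (L₁ ⧸ S₁)) (β : MulAut (L₂ ⧸ S₂)) :
        (L₁ ⧸ S₁) × (L₂ ⧸ S₂) ≃* (L₁ ⧸ S₁) × (L₂ ⧸ S₂)) : _ →* _) =
      (tensorClass S₁ S₂).ker := by
  have := finite_ker_tensorClass (S₁ := S₁) (S₂ := S₂)
  refine Subgroup.eq_of_le_of_card_ge ?_ ?_
  · rintro _ ⟨⟨g, h⟩, hgh, rfl⟩
    obtain ⟨c, h₁, h₂, rfl, rfl⟩ := mem_ker_tensorClass.1 hgh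
    obtain ⟨c', h₁', h₂', e₁, e₂⟩ := H c h₁ h₂
    refine mem_ker_tensorClass.2 ⟨c', h₁', h₂', e₁, ?_⟩
    change (β : MulAut (L₂ ⧸ S₂)) _⁻¹ = _
    rw [map_inv, e₂]
  · rw [Subgroup.card_map_of_injective (MulEquiv.injective _)]

/-- `α × β` descends to the quotient by the kernel of `tensorClass`, which is the quotient group of
the double layer. The inverse is given by `α⁻¹` and `β⁻¹` in the same way, so it is local too. -/
theorem AgreeOnScalars.exists_isTensor {α : MQCA L₁ S₁} {β : MQCA L₂ S₂}
    (H : AgreeOnScalars α β) : ∃ γ, IsTensor α β γ := by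
  let q := QuotientGroup.quotientKerEquivOfSurjective (tensorClass S₁ S₂) tensorClass_surjective
  let γ : MulAut (tensorGroup L₁ L₂ ⧸ tensorSubgroup S₁ S₂) :=
    q.symm.trans ((QuotientGroup.congr _ _ _ H.map_ker).trans q)
  have hγ : ∀ g h, γ (tensorClass S₁ S₂ (g, h)) =
      tensorClass S₁ S₂ ((α : MulAut (L₁ ⧸ S₁)) g, (β : MulAut (L₂ ⧸ S₂)) h) := by
    intro g h
    have : q.symm (tensorClass S₁ S₂ (g, h)) = QuotientGroup.mk (g, h) :=
      q.symm_apply_eq.2 rfl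
    change q (QuotientGroup.congr _ _ _ H.map_ker (q.symm _)) = _
    rw [this]
    rfl
  have hγ' : ∀ g h, γ.symm (tensorClass S₁ S₂ (g, h)) =
      tensorClass S₁ S₂ ((α : MulAut (L₁ ⧸ S₁)).symm g, (β : MulAut (L₂ ⧸ S₂)).symm h) := by
    intro g h
    rw [MulEquiv.symm_apply_eq, hγ, MulEquiv.apply_symm_apply, MulEquiv.apply_symm_apply]
  exact ⟨⟨γ, LocalityPreserving.of_tensorClass α.2.1 β.2.1 hγ,
    LocalityPreserving.of_tensorClass α.2.2 β.2.2 hγ'⟩, isTensor_iff.2 hγ⟩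

theorem existsUnique_isTensor_iff (α : MQCA L₁ S₁) (β : MQCA L₂ S₂) :
    (∃! γ, IsTensor α β γ) ↔ AgreeOnScalars α β := by
  refine ⟨fun ⟨γ, hγ, _⟩ => hγ.agreeOnScalars, fun H => ?_⟩
  obtain ⟨γ, hγ⟩ := H.exists_isTensor
  refine ⟨γ, hγ, fun γ' hγ' => Subtype.ext (MulEquiv.ext fun t => ?_)⟩
  obtain ⟨⟨g, h⟩, rfl⟩ := tensorClass_surjective t
  rw [isTensor_iff.1 hγ, isTensor_iff.1 hγ']

/-- Representatives of `[P ⊗ Q]` are determined up to the stabilizers and a scalar moved between the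
factors; scalars have empty support, so the region is not affected. -/
theorem tensorClass_mem_classesOn {R : Set ℤ} {g : L₁ ⧸ S₁} {h : L₂ ⧸ S₂} :
    tensorClass S₁ S₂ (g, h) ∈ classesOn (tensorGroup L₁ L₂) (tensorSubgroup S₁ S₂) R ↔
      g ∈ classesOn L₁ S₁ R ∧ h ∈ classesOn L₂ S₂ R := by
  constructor
  · intro H
    induction g using QuotientGroup.induction_on with | _ P
    induction h using QuotientGroup.induction_on with | _ Q
    obtain ⟨T, hT, hTe⟩ := mem_classesOn.1 H
    obtain ⟨P', Q', rfl⟩ := tensorElt_surjective T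
    rw [tensorClass_mk] at hTe
    have hT' : Λ₁.supp P' ∪ Λ₂.supp Q' ⊆ R := (supp_pauliTensor _ _).symm.subset.trans hT
    obtain ⟨c, h₁, h₂, e₁, e₂⟩ := mk_tensorElt_eq hTe.symm
    have hs : ∀ {Λ : QubitChain}, PauliOp.scalar c ∈ Λ.supportedOn R := fun {Λ} =>
      (supp_scalar Λ c).subset.trans (Set.empty_subset _)
    refine ⟨⟨P' * ⟨_, h₁⟩, ?_, e₁.symm⟩, ⟨Q' * ⟨_, h₂⟩⁻¹, ?_, ?_⟩⟩
    · exact mul_mem (s := Λ₁.supportedOn R) (Set.subset_union_left.trans hT') hs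
    · exact mul_mem (s := Λ₂.supportedOn R) (Set.subset_union_right.trans hT') (inv_mem hs)
    · change (QuotientGroup.mk _ : L₂ ⧸ S₂) = _
      rw [QuotientGroup.mk_mul, ← e₂, ← QuotientGroup.mk_mul, mul_inv_cancel_right]
  · rintro ⟨⟨P, hP, rfl⟩, ⟨Q, hQ, rfl⟩⟩
    refine ⟨tensorElt P Q, ?_, (tensorClass_mk P Q).symm⟩
    exact (supp_pauliTensor _ _).subset.trans (Set.union_subset hP hQ)

theorem tensorClass_mem_classesAtNegInf {g : L₁ ⧸ S₁} {h : L₂ ⧸ S₂} :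
    tensorClass S₁ S₂ (g, h) ∈ classesAtNegInf (tensorGroup L₁ L₂) (tensorSubgroup S₁ S₂) ↔
      g ∈ classesAtNegInf L₁ S₁ ∧ h ∈ classesAtNegInf L₂ S₂ := by
  simp only [classesAtNegInf, Subgroup.mem_iInf, tensorClass_mem_classesOn, forall_and]

theorem tensorClass_mem_classesAtPosInf {g : L₁ ⧸ S₁} {h : L₂ ⧸ S₂} :
    tensorClass S₁ S₂ (g, h) ∈ classesAtPosInf (tensorGroup L₁ L₂) (tensorSubgroup S₁ S₂) ↔
      g ∈ classesAtPosInf L₁ S₁ ∧ h ∈ classesAtPosInf L₂ S₂ := by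
  simp only [classesAtPosInf, Subgroup.mem_iInf, tensorClass_mem_classesOn, forall_and]

theorem classesOn_empty_le_classesAtInf {Λ : QubitChain} (L : Subgroup Λ.Pauli) (S : Subgroup L)
    [S.Normal] : classesOn L S ∅ ≤ classesAtInf L S :=
  le_sup_of_le_left (le_iInf fun _ => classesOn_mono (Set.empty_subset _))

theorem tensorClass_mem_classesAtInf {g : L₁ ⧸ S₁} {h : L₂ ⧸ S₂}
    (H : tensorClass S₁ S₂ (g, h) ∈
      classesAtInf (tensorGroup L₁ L₂) (tensorSubgroup S₁ S₂)) :
    g ∈ classesAtInf L₁ S₁ ∧ h ∈ classesAtInf L₂ S₂ := by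
  obtain ⟨a, ha, b, hb, hab⟩ := Subgroup.mem_sup_of_normal_left.1 H
  obtain ⟨⟨a₁, a₂⟩, rfl⟩ := tensorClass_surjective a
  obtain ⟨⟨b₁, b₂⟩, rfl⟩ := tensorClass_surjective b
  have ha' := tensorClass_mem_classesAtNegInf.1 ha
  have hb' := tensorClass_mem_classesAtPosInf.1 hb
  -- This element is `1`, hence a class on `∅`; the preceding lemmas then make both components
  -- classes on `∅`, that is, classes of scalars, which lie at infinity.
  have h1 : tensorClass S₁ S₂ ((a₁ * b₁)⁻¹ * g, (a₂ * b₂)⁻¹ * h) ∈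
      classesOn (tensorGroup L₁ L₂) (tensorSubgroup S₁ S₂) ∅ := by
    have : tensorClass S₁ S₂ ((a₁ * b₁)⁻¹ * g, (a₂ * b₂)⁻¹ * h) =
        (tensorClass S₁ S₂ (a₁, a₂) * tensorClass S₁ S₂ (b₁, b₂))⁻¹ *
          tensorClass S₁ S₂ (g, h) := by
      rw [← map_mul, ← map_inv, ← map_mul]
      rfl
    rw [this, hab, inv_mul_cancel]
    exact one_mem _
  obtain ⟨h2, h3⟩ := tensorClass_mem_classesOn.1 h1
  constructor
  · have := mul_mem (mul_mem (Subgroup.mem_sup_left ha'.1) (Subgroup.mem_sup_right hb'.1))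
      (classesOn_empty_le_classesAtInf L₁ S₁ h2)
    rwa [mul_inv_cancel_left] at this
  · have := mul_mem (mul_mem (Subgroup.mem_sup_left ha'.2) (Subgroup.mem_sup_right hb'.2))
      (classesOn_empty_le_classesAtInf L₂ S₂ h3)
    rwa [mul_inv_cancel_left] at this

/-! ### The `ℱ`-space of a double layer -/

variable (S₁ S₂)

theorem localityPreserving_tensorLeft : LocalityPreserving (tensorLeft S₁ S₂) := by
  refine ⟨0, fun P => ⟨tensorElt P 1, rfl, fun k hk => ⟨k, ?_, by simp⟩⟩⟩
  have := (supp_pauliTensor (P : Λ₁.Pauli) (1 : Λ₂.Pauli)).subset hk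
  rwa [supp_one, Set.union_empty] at this

theorem localityPreserving_tensorRight : LocalityPreserving (tensorRight S₁ S₂) := by
  refine ⟨0, fun P => ⟨tensorElt 1 P, rfl, fun k hk => ⟨k, ?_, by simp⟩⟩⟩
  have := (supp_pauliTensor (1 : Λ₁.Pauli) (P : Λ₂.Pauli)).subset hk
  rwa [supp_one, Set.empty_union] at this

/-- The linear map `ℱ₁ × ℱ₂ → ℱ`, where `ℱ` belongs to the double layer. -/
def tensorFMap : FSpace L₁ S₁ × FSpace L₂ S₂ →ₗ[ZMod 2]
    FSpace (tensorGroup L₁ L₂) (tensorSubgroup S₁ S₂) :=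
  (localityPreserving_tensorLeft S₁ S₂).fMap.coprod (localityPreserving_tensorRight S₁ S₂).fMap

variable {S₁ S₂}

theorem tensorFMap_toFSpace (g : L₁ ⧸ S₁) (h : L₂ ⧸ S₂) :
    tensorFMap S₁ S₂ (toFSpace g, toFSpace h) = toFSpace (tensorClass S₁ S₂ (g, h)) := rfl

theorem tensorFMap_bijective : Function.Bijective (tensorFMap S₁ S₂) := by
  constructor
  · rw [← LinearMap.ker_eq_bot, LinearMap.ker_eq_bot']
    rintro ⟨f, f'⟩ hf
    obtain ⟨P, rfl⟩ := toFSpace_mk_surjective f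
    obtain ⟨Q, rfl⟩ := toFSpace_mk_surjective f'
    rw [tensorFMap_toFSpace, toFSpace_eq_zero_iff] at hf
    obtain ⟨h1, h2⟩ := tensorClass_mem_classesAtInf hf
    exact Prod.ext ((toFSpace_eq_zero_iff _).2 h1) ((toFSpace_eq_zero_iff _).2 h2)
  · intro f
    obtain ⟨T, rfl⟩ := toFSpace_mk_surjective f
    obtain ⟨P, Q, rfl⟩ := tensorElt_surjective T
    exact ⟨(toFSpace (P : L₁ ⧸ S₁), toFSpace (Q : L₂ ⧸ S₂)),
      (tensorFMap_toFSpace _ _).trans (congrArg toFSpace (tensorClass_mk P Q))⟩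

variable (S₁ S₂) in
/-- The `ℱ`-space of a double layer is the product of those of the layers. -/
def tensorFEquiv : (FSpace L₁ S₁ × FSpace L₂ S₂) ≃ₗ[ZMod 2]
    FSpace (tensorGroup L₁ L₂) (tensorSubgroup S₁ S₂) :=
  LinearEquiv.ofBijective (tensorFMap S₁ S₂) tensorFMap_bijective

theorem map_tensorFEquiv_FBelow (a : ℤ) :
    ((FBelow L₁ S₁ a).prod (FBelow L₂ S₂ a)).map (tensorFEquiv S₁ S₂ :
      FSpace L₁ S₁ × FSpace L₂ S₂ →ₗ[ZMod 2]
        FSpace (tensorGroup L₁ L₂) (tensorSubgroup S₁ S₂)) =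
      FBelow (tensorGroup L₁ L₂) (tensorSubgroup S₁ S₂) a := by
  ext f
  constructor
  · rintro ⟨⟨f₁, f₂⟩, ⟨h₁, h₂⟩, rfl⟩
    obtain ⟨P, hP, rfl⟩ := mem_FBelow.1 h₁
    obtain ⟨Q, hQ, rfl⟩ := mem_FBelow.1 h₂
    refine mem_FBelow.2 ⟨tensorElt P Q,
      (supp_pauliTensor _ _).subset.trans (Set.union_subset hP hQ), ?_⟩
    exact congrArg toFSpace (tensorClass_mk P Q).symm
  · intro hf
    obtain ⟨T, hT, rfl⟩ := mem_FBelow.1 hf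
    obtain ⟨P, Q, rfl⟩ := tensorElt_surjective T
    have hT' := (supp_pauliTensor (P : Λ₁.Pauli) (Q : Λ₂.Pauli)).symm.subset.trans hT
    exact ⟨(toFSpace (P : L₁ ⧸ S₁), toFSpace (Q : L₂ ⧸ S₂)),
      ⟨mem_FBelow.2 ⟨P, Set.subset_union_left.trans hT', rfl⟩,
        mem_FBelow.2 ⟨Q, Set.subset_union_right.trans hT', rfl⟩⟩,
      congrArg toFSpace (tensorClass_mk P Q)⟩

/-- Under `tensorFEquiv` the cut `ℱ_{<0}` is the product of the two cuts and `γ` acts as `ᾱ × β̄`;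
relative dimension is additive on products. -/
theorem IsTensor.Ind_eq {α : MQCA L₁ S₁} {β : MQCA L₂ S₂}
    {γ : MQCA (tensorGroup L₁ L₂) (tensorSubgroup S₁ S₂)} (H : IsTensor α β γ) :
    Ind γ = Ind α + Ind β := by
  have h₁ := isCut_FBelow (L := L₁) (S := S₁) 0
  have h₂ := isCut_FBelow (L := L₂) (S := S₂) 0
  have key : ((FBelow (tensorGroup L₁ L₂) (tensorSubgroup S₁ S₂) 0).map
        (inducedEquiv γ : FSpace _ _ →ₗ[ZMod 2] FSpace _ _)) =
      (((FBelow L₁ S₁ 0).map (inducedEquiv α : FSpace _ _ →ₗ[ZMod 2] FSpace _ _)).prod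
        ((FBelow L₂ S₂ 0).map (inducedEquiv β : FSpace _ _ →ₗ[ZMod 2] FSpace _ _))).map
        (tensorFEquiv S₁ S₂ : FSpace L₁ S₁ × FSpace L₂ S₂ →ₗ[ZMod 2]
          FSpace (tensorGroup L₁ L₂) (tensorSubgroup S₁ S₂)) := by
    rw [← map_tensorFEquiv_FBelow, ← LinearMap.prodMap_map_prod, ← Submodule.map_comp,
      ← Submodule.map_comp]
    congr 1
    refine LinearMap.ext fun ⟨f, f'⟩ => ?_
    obtain ⟨P, rfl⟩ := toFSpace_mk_surjective f
    obtain ⟨Q, rfl⟩ := toFSpace_mk_surjective f'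
    exact congrArg toFSpace (isTensor_iff.1 H P Q)
  rw [Ind_eq_relDim α h₁, Ind_eq_relDim β h₂, Ind_eq_relDim γ (isCut_FBelow 0), key,
    ← map_tensorFEquiv_FBelow, relDim_map_equiv, relDim_prod]
  · push_cast
    ring
  · exact (isCut_map_inducedEquiv α h₁).finiteRelCodim h₁
  · exact h₁.finiteRelCodim (isCut_map_inducedEquiv α h₁)
  · exact (isCut_map_inducedEquiv β h₂).finiteRelCodim h₂
  · exact h₂.finiteRelCodim (isCut_map_inducedEquiv β h₂)

end Tensor

/-! ### Automorphisms of the Pauli group -/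

section PauliAutomorphism

/-- The binary vectors `(x, z)` that describe Pauli operators up to phases. -/
abbrev Bits (Λ : QubitChain) : Type := (Λ.Qubit →₀ ZMod 2) × (Λ.Qubit →₀ ZMod 2)

variable {Λ : QubitChain}

/-- The binary vector of a Pauli operator. -/
def bits (p : Λ.Pauli) : Bits Λ := (p.x, p.z)

/-- The Pauli operator `X ^ x Z ^ z`. -/
def ofBits (v : Bits Λ) : Λ.Pauli := ⟨0, v.1, v.2⟩

@[simp] theorem bits_ofBits (v : Bits Λ) : bits (ofBits v) = v := rfl

@[simp] theorem bits_mul (p q : Λ.Pauli) : bits (p * q) = bits p + bits q := rfl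

@[simp] theorem bits_scalar (c : ZMod 4) : bits (PauliOp.scalar c : Λ.Pauli) = 0 := rfl

theorem scalar_mul_ofBits_bits (p : Λ.Pauli) :
    PauliOp.scalar p.phase * ofBits (bits p) = p := by
  rw [PauliOp.scalar_mul]
  exact PauliOp.ext (add_zero _) rfl rfl

theorem eq_scalar_of_bits_eq_zero {p : Λ.Pauli} (h : bits p = 0) :
    p = PauliOp.scalar p.phase :=
  PauliOp.ext rfl (congrArg Prod.fst h) (congrArg Prod.snd h)

theorem eq_mul_scalar_of_bits_eq {p q : Λ.Pauli} (h : bits p = bits q) :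
    ∃ c, p = q * PauliOp.scalar c := by
  refine ⟨p.phase - q.phase, ?_⟩
  rw [PauliOp.mul_scalar]
  exact PauliOp.ext (by ring) (congrArg Prod.fst h) (congrArg Prod.snd h)

variable (Λ) in
/-- The binary vectors supported on `R`. -/
def bitsOn (R : Set ℤ) : Submodule (ZMod 2) (Bits Λ) where
  carrier := {v | ∀ j, Λ.site j ∉ R → v.1 j = 0 ∧ v.2 j = 0}
  zero_mem' _ _ := ⟨rfl, rfl⟩
  add_mem' {v w} hv hw j hj := by simp [hv j hj, hw j hj]
  smul_mem' c v hv j hj := by simp [hv j hj]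

theorem mem_bitsOn {R : Set ℤ} {v : Bits Λ} :
    v ∈ bitsOn Λ R ↔ ∀ j, Λ.site j ∉ R → v.1 j = 0 ∧ v.2 j = 0 := Iff.rfl

theorem supp_subset_iff {R : Set ℤ} {p : Λ.Pauli} : Λ.supp p ⊆ R ↔ bits p ∈ bitsOn Λ R := by
  constructor
  · intro h j hj
    by_contra hne
    exact hj (h ⟨j, rfl, by
      by_contra h'
      push Not at h'
      exact hne h'⟩)
  · rintro h k ⟨j, rfl, hj⟩
    by_contra hk
    have := h j hk
    simp only [bits] at this
    tauto

theorem bitsOn_mono {R R' : Set ℤ} (h : R ⊆ R') : bitsOn Λ R ≤ bitsOn Λ R' :=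
  fun _ hv j hj => hv j fun hj' => hj (h hj')

theorem bitsOn_inter (R R' : Set ℤ) : bitsOn Λ (R ∩ R') = bitsOn Λ R ⊓ bitsOn Λ R' := by
  ext v
  simp only [Submodule.mem_inf, mem_bitsOn, ← forall_and]
  refine forall_congr' fun j => ?_
  by_cases h : Λ.site j ∈ R <;> by_cases h' : Λ.site j ∈ R' <;> simp [h, h']

theorem bitsOn_empty : bitsOn Λ ∅ = ⊥ := by
  ext v
  simp only [mem_bitsOn, Set.mem_empty_iff_false, not_false_eq_true, forall_const,
    Submodule.mem_bot]
  constructor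
  · intro h
    exact Prod.ext (Finsupp.ext fun j => (h j).1) (Finsupp.ext fun j => (h j).2)
  · rintro rfl j
    exact ⟨rfl, rfl⟩

/-- The vectors of single-qubit `X` and `Z` on `R` span `bitsOn Λ R`. -/
theorem bitsOn_le {R : Set ℤ} {M : Submodule (ZMod 2) (Bits Λ)}
    (h : ∀ j, Λ.site j ∈ R → (Finsupp.single j 1, 0) ∈ M ∧ (0, Finsupp.single j 1) ∈ M) :
    bitsOn Λ R ≤ M := by
  rintro ⟨x, z⟩ hv
  have hx : ((x, 0) : Bits Λ) ∈ M := by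
    have e : ((x, 0) : Bits Λ) = x.sum fun j b => b • ((Finsupp.single j 1, 0) : Bits Λ) := by
      have e' := congrArg (LinearMap.inl (ZMod 2) (Λ.Qubit →₀ ZMod 2) (Λ.Qubit →₀ ZMod 2))
        (Finsupp.sum_single x)
      rw [Finsupp.sum, map_sum] at e'
      refine e'.symm.trans (Finset.sum_congr rfl fun j _ => ?_)
      simp
    rw [e]
    refine M.sum_mem fun j hj => M.smul_mem _ (h j ?_).1
    by_contra hR
    exact Finsupp.mem_support_iff.1 hj (hv j hR).1
  have hz : ((0, z) : Bits Λ) ∈ M := by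
    have e : ((0, z) : Bits Λ) = z.sum fun j b => b • ((0, Finsupp.single j 1) : Bits Λ) := by
      have e' := congrArg (LinearMap.inr (ZMod 2) (Λ.Qubit →₀ ZMod 2) (Λ.Qubit →₀ ZMod 2))
        (Finsupp.sum_single z)
      rw [Finsupp.sum, map_sum] at e'
      refine e'.symm.trans (Finset.sum_congr rfl fun j _ => ?_)
      simp
    rw [e]
    refine M.sum_mem fun j hj => M.smul_mem _ (h j ?_).2
    by_contra hR
    exact Finsupp.mem_support_iff.1 hj (hv j hR).2
  simpa using M.add_mem hx hz

theorem single_mem_bitsOn {R : Set ℤ} {j : Λ.Qubit} (hj : Λ.site j ∈ R) :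
    (Finsupp.single j 1, 0) ∈ bitsOn Λ R ∧ (0, Finsupp.single j 1) ∈ bitsOn Λ R := by
  classical
  have h : ∀ i, Λ.site i ∉ R → Finsupp.single j (1 : ZMod 2) i = 0 := fun i hi =>
    Finsupp.single_eq_of_ne fun h => hi (h ▸ hj)
  exact ⟨fun i hi => ⟨h i hi, rfl⟩, fun i hi => ⟨rfl, h i hi⟩⟩

theorem bitsOn_union (R R' : Set ℤ) : bitsOn Λ (R ∪ R') = bitsOn Λ R ⊔ bitsOn Λ R' := by
  apply le_antisymm
  · refine bitsOn_le fun j hj => ?_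
    rcases hj with hj | hj
    · exact (single_mem_bitsOn hj).imp (fun h => Submodule.mem_sup_left h)
        (fun h => Submodule.mem_sup_left h)
    · exact (single_mem_bitsOn hj).imp (fun h => Submodule.mem_sup_right h)
        (fun h => Submodule.mem_sup_right h)
  · exact sup_le (bitsOn_mono Set.subset_union_left) (bitsOn_mono Set.subset_union_right)

/-! ### Commutation relations and supports -/

theorem signPhase_injective : Function.Injective signPhase := by decide

theorem pauli_commute_iff (p q : Λ.Pauli) : Commute p q ↔ bitDot p.z q.x = bitDot q.z p.x := by
  constructor
  · intro h
    have := congrArg PauliOp.phase h.eq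
    simp only [PauliOp.mul_phase] at this
    refine signPhase_injective ?_
    linear_combination this
  · intro h
    refine PauliOp.ext ?_ (add_comm _ _) (add_comm _ _)
    simp only [PauliOp.mul_phase, h]
    ring

theorem bitDot_eq_zero {N : Type} {z x : N →₀ ZMod 2} (h : ∀ j, z j = 0 ∨ x j = 0) :
    bitDot z x = 0 :=
  Finset.sum_eq_zero fun j _ => mul_eq_zero.2 (h j)

theorem bitDot_single_right {N : Type} (z : N →₀ ZMod 2) (j : N) :
    bitDot z (Finsupp.single j 1) = z j := by
  simp [bitDot]

theorem bitDot_single_left {N : Type} (x : N →₀ ZMod 2) (j : N) :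
    bitDot (Finsupp.single j 1) x = x j := by
  classical
  simp only [bitDot, Finsupp.single_apply, ite_mul, one_mul, zero_mul]
  rw [Finsupp.sum_ite_eq]
  split_ifs with h
  · rfl
  · exact (Finsupp.notMem_support_iff.1 h).symm

theorem pauli_commute_of_disjoint {R : Set ℤ} {p q : Λ.Pauli} (hp : bits p ∈ bitsOn Λ R)
    (hq : bits q ∈ bitsOn Λ Rᶜ) : Commute p q := by
  have h : ∀ j, (p.x j = 0 ∧ p.z j = 0) ∨ (q.x j = 0 ∧ q.z j = 0) := fun j => by
    by_cases hj : Λ.site j ∈ R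
    · exact Or.inr (hq j fun h => h hj)
    · exact Or.inl (hp j hj)
  rw [pauli_commute_iff, bitDot_eq_zero fun j => ?_, bitDot_eq_zero fun j => ?_]
  · rcases h j with h | h
    · exact Or.inr h.1
    · exact Or.inl h.2
  · rcases h j with h | h
    · exact Or.inl h.2
    · exact Or.inr h.1

/-- Single-qubit operators detect the support: commuting with `Z_j` forces the `x`-bit at `j` to
vanish, commuting with `X_j` the `z`-bit. -/
theorem bits_mem_of_commute {R : Set ℤ} {q : Λ.Pauli}
    (h : ∀ p : Λ.Pauli, bits p ∈ bitsOn Λ R → Commute p q) : bits q ∈ bitsOn Λ Rᶜ := by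
  intro j hj
  have hj' : Λ.site j ∈ R := not_not.1 hj
  constructor
  · have := (pauli_commute_iff _ _).1 (h (ofBits (0, Finsupp.single j 1))
      (single_mem_bitsOn hj').2)
    simp only [ofBits, bitDot_single_left, bitDot_zero_right] at this
    exact this
  · have := (pauli_commute_iff _ _).1 (h (ofBits (Finsupp.single j 1, 0))
      (single_mem_bitsOn hj').1)
    simp only [ofBits, bitDot_single_right, bitDot_zero_left] at this
    exact this.symm

/-! ### The action of an automorphism on binary vectors -/

variable (a : Λ.Pauli ≃* Λ.Pauli)

/-- Scalars are central, so their images are central, and a Pauli that commutes with all others has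
empty support. -/
theorem bits_map_scalar (c : ZMod 4) : bits (a (PauliOp.scalar c)) = 0 := by
  have h : bits (a (PauliOp.scalar c)) ∈ bitsOn Λ (Set.univ)ᶜ := by
    refine bits_mem_of_commute fun p _ => ?_
    have : Commute (a.symm p) (PauliOp.scalar c) := by
      rw [pauli_commute_iff]
      simp [PauliOp.scalar, bitDot_zero_left, bitDot_zero_right]
    simpa using this.map a
  rwa [Set.compl_univ, bitsOn_empty] at h

theorem bits_map_congr {p q : Λ.Pauli} (h : bits p = bits q) : bits (a p) = bits (a q) := by
  obtain ⟨c, rfl⟩ := eq_mul_scalar_of_bits_eq h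
  rw [map_mul, bits_mul, bits_map_scalar, add_zero]

/-- The linear map of binary vectors induced by an automorphism of the Pauli group. -/
def bitsMap : Bits Λ →ₗ[ZMod 2] Bits Λ :=
  AddMonoidHom.toZModLinearMap 2
    { toFun := fun v => bits (a (ofBits v))
      map_zero' := bits_map_scalar a 0
      map_add' := fun v w => by
        rw [← bits_mul, ← map_mul]
        exact bits_map_congr a rfl }

theorem bitsMap_bits (p : Λ.Pauli) : bitsMap a (bits p) = bits (a p) :=
  bits_map_congr a rfl

/-- The automorphism of binary vectors induced by an automorphism of the Pauli group. -/
def bitsEquiv : Bits Λ ≃ₗ[ZMod 2] Bits Λ :=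
  LinearEquiv.ofLinearMap (bitsMap a) (bitsMap a.symm)
    (LinearMap.ext fun v => by
      change bitsMap a (bitsMap a.symm (bits (ofBits v))) = v
      rw [bitsMap_bits, bitsMap_bits, a.apply_symm_apply, bits_ofBits])
    (LinearMap.ext fun v => by
      change bitsMap a.symm (bitsMap a (bits (ofBits v))) = v
      rw [bitsMap_bits, bitsMap_bits, a.symm_apply_apply, bits_ofBits])

theorem bitsEquiv_bits (p : Λ.Pauli) : bitsEquiv a (bits p) = bits (a p) := bitsMap_bits a p

theorem bitsEquiv_symm : (bitsEquiv a).symm = bitsEquiv a.symm := rfl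

/-- Since an automorphism preserves commutation relations, its locality properties are inherited by
the inverse. -/
theorem bitsEquiv_symm_mapsTo_compl {R R' : Set ℤ}
    (h : ∀ v ∈ bitsOn Λ R, bitsEquiv a v ∈ bitsOn Λ R') :
    ∀ v ∈ bitsOn Λ R'ᶜ, (bitsEquiv a).symm v ∈ bitsOn Λ Rᶜ := by
  intro v hv
  rw [bitsEquiv_symm, ← bits_ofBits v, bitsEquiv_bits]
  refine bits_mem_of_commute fun p hp => ?_
  have h1 : bits (a p) ∈ bitsOn Λ R' := by
    rw [← bitsEquiv_bits]
    exact h _ hp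
  have := (pauli_commute_of_disjoint (q := ofBits v) h1 hv).map a.symm
  rwa [a.symm_apply_apply] at this

/-- If `k` is farther than `r` from the support of `p`, then `p` commutes with the images of all
Paulis at `k`. Hence `a⁻¹ p` commutes with all Paulis at `k` and acts trivially there. -/
theorem supp_symm_subset {r : ℕ} (h : ∀ p, Λ.supp (a p) ⊆ nbhd r (Λ.supp p)) (p : Λ.Pauli) :
    Λ.supp (a.symm p) ⊆ nbhd r (Λ.supp p) := by
  intro k hk
  by_contra hn
  have h1 : ∀ v ∈ bitsOn Λ {k}, bitsEquiv a v ∈ bitsOn Λ (nbhd r {k}) := by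
    intro v hv
    rw [← bits_ofBits v] at hv ⊢
    rw [bitsEquiv_bits, ← supp_subset_iff]
    exact (h _).trans (nbhd_mono (supp_subset_iff.2 hv))
  have h2 : bits p ∈ bitsOn Λ (nbhd r {k})ᶜ := by
    rw [← supp_subset_iff]
    rintro i hi ⟨k', rfl, hik⟩
    exact hn ⟨i, hi, by rwa [abs_sub_comm]⟩
  have h3 := bitsEquiv_symm_mapsTo_compl a h1 _ h2
  rw [bitsEquiv_symm, bitsEquiv_bits, ← supp_subset_iff] at h3
  exact h3 hk rfl

end PauliAutomorphism

/-! ### The algebra of local operators -/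

section LocalAlgebra

variable {Λ : QubitChain}

theorem pauliAct_single (p : Λ.Pauli) (s : Λ.Qubit →₀ ZMod 2) :
    pauliAct p (Finsupp.single s 1) =
      Finsupp.single (s + p.x) (Complex.I ^ (p.phase + signPhase (bitDot p.z s)).val) := by
  simp [pauliAct]

theorem localPauli_mul (p q : Λ.Pauli) : localPauli (p * q) = localPauli p * localPauli q :=
  Subtype.ext (pauliAct_mul p q)

theorem pauliAct_one : pauliAct (1 : Λ.Pauli) = 1 := by
  refine Finsupp.lhom_ext' fun s => LinearMap.ext_ring ?_
  rw [LinearMap.comp_apply, Finsupp.lsingle_apply, pauliAct_single]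
  simp [bitDot_zero_left]

theorem localPauli_one : localPauli (1 : Λ.Pauli) = 1 := Subtype.ext pauliAct_one

theorem localPauli_scalar_mul (c : ZMod 4) (p : Λ.Pauli) :
    localPauli (PauliOp.scalar c * p) = Complex.I ^ c.val • localPauli p := by
  refine Subtype.ext (Finsupp.lhom_ext' fun s => LinearMap.ext_ring ?_)
  change pauliAct (PauliOp.scalar c * p) (Finsupp.single s 1) =
    Complex.I ^ c.val • pauliAct p (Finsupp.single s 1)
  rw [pauliAct_single, pauliAct_single, PauliOp.scalar_mul, Finsupp.smul_single, smul_eq_mul,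
    ← I_pow_val_add, add_assoc]

theorem localPauli_eq_smul (p : Λ.Pauli) :
    localPauli p = Complex.I ^ p.phase.val • localPauli (ofBits (bits p)) := by
  conv_lhs => rw [← scalar_mul_ofBits_bits p, localPauli_scalar_mul]

theorem I_pow_val_ne_zero (c : ZMod 4) : Complex.I ^ c.val ≠ 0 := pow_ne_zero _ Complex.I_ne_zero

variable (Λ) in
/-- Pauli operators as local operators. -/
def localPauliHom : Λ.Pauli →* LocalAlg Λ where
  toFun := localPauli
  map_one' := localPauli_one
  map_mul' := localPauli_mul

/-- The Paulis on `R` are closed under multiplication, so the algebra they generate is their span;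
phases are complex scalars, so one Pauli per binary vector suffices. -/
theorem localOn_toSubmodule (R : Set ℤ) : Subalgebra.toSubmodule (localOn Λ R) =
    Submodule.span ℂ ((fun v => localPauli (ofBits v)) '' (bitsOn Λ R : Set (Bits Λ))) := by
  have e : localPauli '' (Λ.supportedOn R : Set Λ.Pauli) =
      ((Λ.supportedOn R).toSubmonoid.map (localPauliHom Λ) : Set (LocalAlg Λ)) := rfl
  rw [localOn, Algebra.adjoin_eq_span, e, Submonoid.closure_eq]
  apply le_antisymm <;> rw [Submodule.span_le]
  · rintro _ ⟨p, hp, rfl⟩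
    change localPauli p ∈ _
    rw [localPauli_eq_smul]
    exact Submodule.smul_mem _ _ (Submodule.subset_span ⟨_, supp_subset_iff.1 hp, rfl⟩)
  · rintro _ ⟨v, hv, rfl⟩
    exact Submodule.subset_span ⟨ofBits v, supp_subset_iff.2 hv, rfl⟩

theorem localOn_univ : localOn Λ Set.univ = ⊤ := by
  have h := Algebra.adjoin_adjoin_coe_preimage (R := ℂ) (s := Set.range (pauliAct (Λ := Λ)))
  refine Eq.trans (congrArg (Algebra.adjoin ℂ) ?_) h
  ext A
  constructor
  · rintro ⟨p, -, rfl⟩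
    exact ⟨p, rfl⟩
  · rintro ⟨p, hp⟩
    exact ⟨p, fun _ _ => trivial, Subtype.ext hp⟩

theorem span_localPauli_ofBits :
    Submodule.span ℂ (Set.range fun v : Bits Λ => localPauli (ofBits v)) = ⊤ := by
  have h := localOn_toSubmodule (Λ := Λ) Set.univ
  have e : (bitsOn Λ Set.univ : Set (Bits Λ)) = Set.univ :=
    Set.eq_univ_of_forall fun v j hj => absurd trivial hj
  rw [e, Set.image_univ, localOn_univ, Algebra.top_toSubmodule] at h
  exact h.symm

/-! ### The Pauli basis of the local algebra -/

/-- The character `s ↦ (-1) ^ (z · s)` of the group of bit strings. -/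
def bitCharacter {N : Type} (z : N →₀ ZMod 2) : Multiplicative (N →₀ ZMod 2) →* ℂ where
  toFun s := Complex.I ^ (signPhase (bitDot z s.toAdd)).val
  map_one' := by simp [bitDot_zero_right]
  map_mul' s t := by
    rw [toAdd_mul, bitDot_add_right, map_add, I_pow_val_add]

theorem bitCharacter_injective {N : Type} :
    Function.Injective (bitCharacter : (N →₀ ZMod 2) → _) := by
  have key : ∀ t t' : ZMod 2, Complex.I ^ (signPhase t).val = Complex.I ^ (signPhase t').val →
      t = t' := by
    have h2 : (signPhase 1).val = 2 := by decide
    have h : ∀ t : ZMod 2, t = 0 ∨ t = 1 := by decide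
    intro t t'
    rcases h t with rfl | rfl <;> rcases h t' with rfl | rfl <;>
      simp [h2] <;> norm_num
  intro z w h
  ext j
  have := key _ _ (DFunLike.congr_fun h (Multiplicative.ofAdd (Finsupp.single j 1)))
  simpa [bitDot_single_right] using this

variable (Λ) in
/-- The matrix elements of local operators. -/
def matrixElement : LocalAlg Λ →ₗ[ℂ] (Bits Λ → ℂ) where
  toFun A st := (A : Module.End ℂ (StateSpace Λ)) (Finsupp.single st.1 1) st.2
  map_add' _ _ := rfl
  map_smul' _ _ := rfl

theorem matrixElement_localPauli_ofBits (v : Bits Λ) (s x : Λ.Qubit →₀ ZMod 2)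
    [Decidable (v.1 = x)] :
    matrixElement Λ (localPauli (ofBits v)) (s, s + x) =
      if v.1 = x then bitCharacter v.2 (Multiplicative.ofAdd s) else 0 := by
  classical
  change pauliAct (ofBits v) (Finsupp.single s 1) (s + x) = _
  rw [pauliAct_single, Finsupp.single_apply]
  simp only [ofBits, add_right_inj, zero_add]
  rfl

/-- `X^x Z^z` has nonzero matrix elements only from `s` to `s + x`, where they form the character of
`z`. Operators with different `x` thus have disjoint matrix supports, and those with equal `x` are
independent by Dedekind's theorem on characters. -/
theorem linearIndependent_matrixElement :
    LinearIndependent ℂ fun v : Bits Λ => matrixElement Λ (localPauli (ofBits v)) := by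
  classical
  rw [linearIndependent_iff']
  intro t g hg w hw
  have hchar : LinearIndepOn ℂ
      (fun v : Bits Λ => (bitCharacter v.2 : Multiplicative (Λ.Qubit →₀ ZMod 2) → ℂ))
      {v | v.1 = w.1} := by
    refine (linearIndependent_monoidHom (Multiplicative (Λ.Qubit →₀ ZMod 2)) ℂ).comp
      (fun v : {v : Bits Λ | v.1 = w.1} => bitCharacter v.1.2) fun v v' h => ?_
    exact Subtype.ext (Prod.ext (v.2.trans v'.2.symm) (bitCharacter_injective h))
  rw [linearIndepOn_iff'] at hchar
  refine hchar (t.filter fun v => v.1 = w.1) g (by intro v; simp) ?_ w (by simp [hw])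
  funext s
  -- Evaluation on the pairs `(s, s + w.1)` isolates the terms whose `x`-part is `w.1`.
  have h1 := congrFun hg (s.toAdd, s.toAdd + w.1)
  rw [Finset.sum_apply] at h1 ⊢
  rw [Finset.sum_filter]
  refine Eq.trans (Finset.sum_congr rfl fun v _ => ?_) h1
  rw [Pi.smul_apply, Pi.smul_apply, matrixElement_localPauli_ofBits]
  split_ifs with h
  · rfl
  · simp

theorem linearIndependent_localPauli_ofBits :
    LinearIndependent ℂ fun v : Bits Λ => localPauli (ofBits v) :=
  LinearIndependent.of_comp (matrixElement Λ) linearIndependent_matrixElement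

variable (Λ) in
/-- The Pauli operators `X ^ x Z ^ z` form a basis of the algebra of local operators. -/
def pauliBasis : Module.Basis (Bits Λ) ℂ (LocalAlg Λ) :=
  Module.Basis.mk linearIndependent_localPauli_ofBits span_localPauli_ofBits.ge

theorem pauliBasis_apply (v : Bits Λ) : pauliBasis Λ v = localPauli (ofBits v) :=
  Module.Basis.mk_apply _ _ v

theorem localPauli_eq_smul_basis (p : Λ.Pauli) :
    localPauli p = Complex.I ^ p.phase.val • pauliBasis Λ (bits p) := by
  rw [pauliBasis_apply, ← localPauli_eq_smul]

theorem localOn_eq_span (R : Set ℤ) : Subalgebra.toSubmodule (localOn Λ R) =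
    Submodule.span ℂ (pauliBasis Λ '' (bitsOn Λ R : Set (Bits Λ))) := by
  rw [localOn_toSubmodule]
  congr 2
  funext v
  exact (pauliBasis_apply v).symm

theorem localAlg_induction {C : LocalAlg Λ → Prop} (A : LocalAlg Λ)
    (pauli : ∀ p, C (localPauli p)) (zero : C 0) (add : ∀ A B, C A → C B → C (A + B))
    (smul : ∀ (c : ℂ) A, C A → C (c • A)) : C A := by
  have hA : A ∈ Submodule.span ℂ (Set.range fun v : Bits Λ => localPauli (ofBits v)) := by
    rw [span_localPauli_ofBits]; trivial
  induction hA using Submodule.span_induction with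
  | mem _ h => obtain ⟨v, rfl⟩ := h; exact pauli _
  | zero => exact zero
  | add _ _ _ _ h h' => exact add _ _ h h'
  | smul c _ _ h => exact smul c _ h

/-! ### Adjoints -/

theorem isAdjointOp_localPauli (p : Λ.Pauli) : IsAdjointOp (localPauli p) (localPauli p⁻¹) := by
  classical
  intro s t
  change pauliAct p⁻¹ (Finsupp.single s 1) t = star (pauliAct p (Finsupp.single t 1) s)
  rw [pauliAct_single, pauliAct_single, Finsupp.single_apply, Finsupp.single_apply]
  have hst : s + p.x = t ↔ t + p.x = s := by
    constructor <;> rintro rfl <;> rw [add_assoc, PauliOp.bits_add_self, add_zero]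
  by_cases h : s + p.x = t
  · have hconj : ∀ c : ZMod 4, star (Complex.I ^ c.val) = Complex.I ^ (-c).val := by
      intro c
      have h1 : Complex.I ^ c.val * Complex.I ^ (-c).val = 1 := by
        rw [← I_pow_val_add, add_neg_cancel]; simp
      have h2 : Complex.I ^ c.val * star (Complex.I ^ c.val) = 1 := by
        rw [star_pow, ← mul_pow]
        simp
      exact mul_left_cancel₀ (I_pow_val_ne_zero c) (h2.trans h1.symm)
    have hs : ∀ u : ZMod 2, -signPhase u = signPhase u := by decide
    rw [PauliOp.inv_x, if_pos h, if_pos (hst.1 h), hconj, ← h, bitDot_add_right, map_add]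
    simp only [PauliOp.inv_phase, PauliOp.inv_z, neg_add, hs]
    congr 2
    ring
  · rw [PauliOp.inv_x, if_neg h, if_neg fun h' => h (hst.2 h'), star_zero]

theorem IsAdjointOp.add {A B A' B' : LocalAlg Λ} (h : IsAdjointOp A B) (h' : IsAdjointOp A' B') :
    IsAdjointOp (A + A') (B + B') := by
  intro s t
  have e := h s t
  have e' := h' s t
  change (B : Module.End ℂ (StateSpace Λ)) _ t + (B' : Module.End ℂ (StateSpace Λ)) _ t =
    star ((A : Module.End ℂ (StateSpace Λ)) _ s + (A' : Module.End ℂ (StateSpace Λ)) _ s)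
  rw [e, e', star_add]

theorem IsAdjointOp.smul {A B : LocalAlg Λ} (c : ℂ) (h : IsAdjointOp A B) :
    IsAdjointOp (c • A) (star c • B) := by
  intro s t
  have e := h s t
  change star c * (B : Module.End ℂ (StateSpace Λ)) _ t =
    star (c * (A : Module.End ℂ (StateSpace Λ)) _ s)
  rw [e, star_mul']

theorem IsAdjointOp.unique {A B B' : LocalAlg Λ} (h : IsAdjointOp A B) (h' : IsAdjointOp A B') :
    B = B' := by
  refine Subtype.ext (Finsupp.lhom_ext' fun s => LinearMap.ext_ring (Finsupp.ext fun t => ?_))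
  exact (h s t).trans (h' s t).symm

theorem isAdjointOp_zero : IsAdjointOp (0 : LocalAlg Λ) 0 := by
  intro s t
  simp

/-! ### The QCA that extends an automorphism of the Pauli group -/

section Extension

variable (a : Λ.Pauli ≃* Λ.Pauli)

/-- The linear extension of an automorphism of the Pauli group. -/
def extendLinear : LocalAlg Λ →ₗ[ℂ] LocalAlg Λ :=
  (pauliBasis Λ).constr ℂ fun v => localPauli (a (ofBits v))

variable {a}

/-- By construction this holds for the basis operators without phase; fixing the scalars extends it
to all phases. -/
theorem extendLinear_localPauli (ha : ∀ c, a (PauliOp.scalar c) = PauliOp.scalar c)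
    (p : Λ.Pauli) : extendLinear a (localPauli p) = localPauli (a p) := by
  rw [localPauli_eq_smul_basis, map_smul, extendLinear, Module.Basis.constr_basis,
    ← localPauli_scalar_mul]
  congr 1
  conv_rhs => rw [← scalar_mul_ofBits_bits p, map_mul, ha]

/-- The multiplicative extension of an automorphism of the Pauli group that fixes the scalars. -/
def extendHom (ha : ∀ c, a (PauliOp.scalar c) = PauliOp.scalar c) : LocalAlg Λ →ₐ[ℂ] LocalAlg Λ :=
  AlgHom.ofLinearMap (extendLinear a)
    (by rw [← localPauli_one, extendLinear_localPauli ha, map_one])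
    (by
      intro A B
      induction A using localAlg_induction with
      | zero => simp
      | add A A' h h' => rw [add_mul, map_add, map_add, add_mul, h, h']
      | smul c A h => rw [smul_mul_assoc, map_smul, map_smul, smul_mul_assoc, h]
      | pauli p =>
        induction B using localAlg_induction with
        | zero => simp
        | add A A' h h' => rw [mul_add, map_add, map_add, mul_add, h, h']
        | smul c A h => rw [mul_smul_comm, map_smul, map_smul, mul_smul_comm, h]
        | pauli q =>
          rw [← localPauli_mul, extendLinear_localPauli ha, extendLinear_localPauli ha,
            extendLinear_localPauli ha, map_mul, localPauli_mul])

theorem extendHom_localPauli (ha : ∀ c, a (PauliOp.scalar c) = PauliOp.scalar c)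
    (p : Λ.Pauli) : extendHom ha (localPauli p) = localPauli (a p) :=
  extendLinear_localPauli ha p

theorem algHom_ext_localPauli {f g : LocalAlg Λ →ₐ[ℂ] LocalAlg Λ}
    (h : ∀ p, f (localPauli p) = g (localPauli p)) : f = g := by
  refine AlgHom.ext fun A => ?_
  induction A using localAlg_induction with
  | zero => simp
  | add A A' h h' => rw [map_add, map_add, h, h']
  | smul c A h => rw [map_smul, map_smul, h]
  | pauli p => exact h p

/-- The automorphism of the algebra of local operators that extends an automorphism of the Pauli
group that fixes the scalars. -/
def extendEquiv (ha : ∀ c, a (PauliOp.scalar c) = PauliOp.scalar c) : LocalAlg Λ ≃ₐ[ℂ] LocalAlg Λ :=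
  have ha' : ∀ c, a.symm (PauliOp.scalar c) = PauliOp.scalar c := fun c =>
    a.symm_apply_eq.2 (ha c).symm
  AlgEquiv.ofAlgHom (extendHom ha) (extendHom ha')
    (algHom_ext_localPauli fun p => by
      rw [AlgHom.comp_apply, extendHom_localPauli, extendHom_localPauli, a.apply_symm_apply]
      rfl)
    (algHom_ext_localPauli fun p => by
      rw [AlgHom.comp_apply, extendHom_localPauli, extendHom_localPauli, a.symm_apply_apply]
      rfl)

theorem extendEquiv_localPauli (ha : ∀ c, a (PauliOp.scalar c) = PauliOp.scalar c)
    (p : Λ.Pauli) : extendEquiv ha (localPauli p) = localPauli (a p) :=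
  extendLinear_localPauli ha p

/-- The adjoint of a Pauli is its inverse, which `a` respects; the adjoint relation is additive and
conjugate-linear, and Paulis span the algebra. -/
theorem isUnitaryQCA_extendEquiv (ha : ∀ c, a (PauliOp.scalar c) = PauliOp.scalar c)
    {r : ℕ} (hr : ∀ p, Λ.supp (a p) ⊆ nbhd r (Λ.supp p)) : IsUnitaryQCA (extendEquiv ha) := by
  constructor
  · intro A B hAB
    -- The induction runs on `A` alone and builds some adjoint `B'`; uniqueness of adjoints
    -- identifies it with `B` afterwards.
    have key : ∃ B', IsAdjointOp A B' ∧ IsAdjointOp (extendEquiv ha A) (extendEquiv ha B') := by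
      clear hAB
      induction A using localAlg_induction with
      | zero => exact ⟨0, isAdjointOp_zero, by rw [map_zero]; exact isAdjointOp_zero⟩
      | add A A' h h' =>
        obtain ⟨B, h1, h2⟩ := h
        obtain ⟨B', h1', h2'⟩ := h'
        exact ⟨B + B', h1.add h1', by rw [map_add, map_add]; exact h2.add h2'⟩
      | smul c A h =>
        obtain ⟨B, h1, h2⟩ := h
        exact ⟨star c • B, h1.smul c, by rw [map_smul, map_smul]; exact h2.smul c⟩
      | pauli p =>
        refine ⟨localPauli p⁻¹, isAdjointOp_localPauli p, ?_⟩
        rw [extendEquiv_localPauli, extendEquiv_localPauli, map_inv]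
        exact isAdjointOp_localPauli _
    obtain ⟨B', h1, h2⟩ := key
    rwa [hAB.unique h1]
  · refine ⟨r, fun R => ?_⟩
    rw [localOn, AlgHom.map_adjoin, Algebra.adjoin_le_iff]
    rintro _ ⟨_, ⟨p, hp, rfl⟩, rfl⟩
    refine Algebra.subset_adjoin ⟨a p, (hr p).trans (nbhd_mono hp), ?_⟩
    exact (extendEquiv_localPauli ha p).symm

end Extension

/-! ### Automorphisms that do not fix the scalars -/

variable (Λ) in
/-- Complex conjugation of Pauli operators. -/
def pauliConj : Λ.Pauli ≃* Λ.Pauli where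
  toFun p := ⟨-p.phase, p.x, p.z⟩
  invFun p := ⟨-p.phase, p.x, p.z⟩
  left_inv p := PauliOp.ext (neg_neg _) rfl rfl
  right_inv p := PauliOp.ext (neg_neg _) rfl rfl
  map_mul' p q := by
    have hs : ∀ u : ZMod 2, -signPhase u = signPhase u := by decide
    refine PauliOp.ext ?_ rfl rfl
    simp only [PauliOp.mul_phase, neg_add, hs]

theorem bits_pauliConj (p : Λ.Pauli) : bits (pauliConj Λ p) = bits p := rfl

/-- The scalars form a cyclic group of order 4, whose only automorphisms are the identity and
inversion. -/
theorem map_scalar_eq_or (a : Λ.Pauli ≃* Λ.Pauli) :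
    (∀ c, a (PauliOp.scalar c) = PauliOp.scalar c) ∨
      ∀ c, a (PauliOp.scalar c) = PauliOp.scalar (-c) := by
  let f : ZMod 4 → ZMod 4 := fun c => (a (PauliOp.scalar c)).phase
  have hf : ∀ c, a (PauliOp.scalar c) = PauliOp.scalar (f c) := fun c =>
    eq_scalar_of_bits_eq_zero (bits_map_scalar a c)
  have hscalar : ∀ c d : ZMod 4, (PauliOp.scalar (c + d) : Λ.Pauli) =
      PauliOp.scalar c * PauliOp.scalar d := fun c d => by
    rw [PauliOp.scalar_mul]; rfl
  have hadd : ∀ c d, f (c + d) = f c + f d := fun c d => by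
    have : PauliOp.scalar (f (c + d)) = (PauliOp.scalar (f c + f d) : Λ.Pauli) := by
      rw [← hf, hscalar, map_mul, hf, hf, hscalar]
    exact congrArg PauliOp.phase this
  have hinj : Function.Injective f := fun c d h => by
    have : a (PauliOp.scalar c) = a (PauliOp.scalar d) := by rw [hf, hf, h]
    exact congrArg PauliOp.phase (a.injective this)
  have h0 : f 0 = 0 := by simpa using hadd 0 0
  have h2 : f 2 = f 1 + f 1 := hadd 1 1
  have h3 : f 3 = f 1 + f 1 + f 1 := by rw [← h2]; exact hadd 2 1
  -- The image of `i` has order 4, so its exponent is `1` or `3`.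
  have hne : f 1 + f 1 ≠ 0 := by
    rw [← h2, ← h0]
    exact fun h => absurd (hinj h) (by decide)
  have hcase : ∀ d : ZMod 4, d + d ≠ 0 → d = 1 ∨ d = 3 := by decide
  have hall : ∀ c : ZMod 4, c = 0 ∨ c = 1 ∨ c = 2 ∨ c = 3 := by decide
  refine (hcase _ hne).imp (fun h c => ?_) fun h c => ?_ <;> rw [hf c] <;>
    rcases hall c with rfl | rfl | rfl | rfl <;> simp only [h0, h2, h3, h] <;> rfl

/-- Every locality-preserving automorphism of the Pauli group is implemented, up to phases, by a
unitary QCA. -/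
theorem exists_isUnitaryQCA_up_to_phase (a : Λ.Pauli ≃* Λ.Pauli) {r : ℕ}
    (hr : ∀ p, Λ.supp (a p) ⊆ nbhd r (Λ.supp p)) :
    ∃ Φ : LocalAlg Λ ≃ₐ[ℂ] LocalAlg Λ, IsUnitaryQCA Φ ∧
      ∀ p, ∃ c, Φ (localPauli p) = localPauli (PauliOp.scalar c * a p) := by
  rcases map_scalar_eq_or a with h | h
  · exact ⟨extendEquiv h, isUnitaryQCA_extendEquiv h hr, fun p => ⟨0, by
      rw [extendEquiv_localPauli]; exact congrArg localPauli (one_mul _).symm⟩⟩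
  -- Conjugation inverts the scalars as `a` does, so the composite fixes them; it leaves bits
  -- unchanged, so the composite agrees with `a` up to phases and has the same locality.
  · have h' : ∀ c, ((pauliConj Λ).trans a) (PauliOp.scalar c) = PauliOp.scalar c := fun c =>
      (h (-c)).trans (by rw [neg_neg])
    refine ⟨extendEquiv h', isUnitaryQCA_extendEquiv h' (r := r) fun p => hr _, fun p => ?_⟩
    obtain ⟨c, hc⟩ := eq_mul_scalar_of_bits_eq (bits_map_congr a (bits_pauliConj p))
    refine ⟨c, ?_⟩
    rw [extendEquiv_localPauli]
    refine congrArg localPauli (hc.trans ?_)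
    rw [PauliOp.mul_scalar, PauliOp.scalar_mul, add_comm]

end LocalAlgebra

/-! ### The index of an automorphism of the Pauli group -/

section PauliIndex

variable {Λ : QubitChain}

theorem FiniteRelCodim.of_sup_eq {K V : Type} [Field K] [AddCommGroup V] [Module K V]
    {X T Y : Submodule K V} (hs : X ⊔ T = Y) [FiniteDimensional K T] : FiniteRelCodim X Y := by
  unfold FiniteRelCodim
  rw [← hs, Submodule.map_sup, X.mkQ_map_self, bot_sup_eq]
  infer_instance

theorem finite_bitsOn_Ico (a b : ℤ) : Finite (bitsOn Λ (Set.Ico a b)) := by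
  have hfin : (Λ.site ⁻¹' Set.Ico a b).Finite :=
    (Set.finite_Ico a b).preimage' fun k _ => Λ.finite_site k
  have : Finite (Λ.site ⁻¹' Set.Ico a b) := hfin
  refine Finite.of_injective (β := (Λ.site ⁻¹' Set.Ico a b) → ZMod 2 × ZMod 2)
    (fun v j => (v.1.1 j, v.1.2 j)) fun v w h => Subtype.ext ?_
  have key : ∀ j, v.1.1 j = w.1.1 j ∧ v.1.2 j = w.1.2 j := fun j => by
    by_cases hj : Λ.site j ∈ Set.Ico a b
    · exact Prod.ext_iff.1 (congrFun h ⟨j, hj⟩)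
    · rw [(v.2 j hj).1, (v.2 j hj).2, (w.2 j hj).1, (w.2 j hj).2]
      exact ⟨rfl, rfl⟩
  exact Prod.ext (Finsupp.ext fun j => (key j).1) (Finsupp.ext fun j => (key j).2)

theorem disjoint_bitsOn {R R' : Set ℤ} (h : Disjoint R R') :
    Disjoint (bitsOn Λ R) (bitsOn Λ R') := by
  rw [disjoint_iff, ← bitsOn_inter, Set.disjoint_iff_inter_eq_empty.1 h, bitsOn_empty]

/-- A strictly increasing integer sequence moves by at least one per step, so it is unbounded in
both directions and its cells cover `ℤ`. -/
theorem exists_mem_Ico_of_strictMono {m : ℤ → ℤ} (hm : StrictMono m) (k : ℤ) :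
    ∃ i, k ∈ Set.Ico (m i) (m (i + 1)) := by
  have hmono : Monotone fun i => m i - i := monotone_int_of_le_succ fun i => by
    have := hm (lt_add_one i)
    linarith
  obtain ⟨i, hi, hmax⟩ := Int.exists_greatest_of_bdd (P := fun i => m i ≤ k)
    ⟨max 0 (k - m 0), fun z hz => by
      rcases le_total z 0 with h | h
      · exact h.trans (le_max_left _ _)
      · have := hmono h
        simp only [sub_zero] at this
        exact le_max_of_le_right (by linarith)⟩
    ⟨min 0 (k - m 0), by
      have := hmono (min_le_left 0 (k - m 0))
      have h2 := min_le_right 0 (k - m 0)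
      simp only [sub_zero] at this
      linarith⟩
  refine ⟨i, hi, ?_⟩
  by_contra h
  have := hmax (i + 1) (not_lt.1 h)
  linarith

/-- An automorphism of the Pauli group that maps cells to their neighbourhoods. -/
def MapsCells (a : Λ.Pauli ≃* Λ.Pauli) (m : ℤ → ℤ) : Prop :=
  ∀ i : ℤ, ∀ v ∈ bitsOn Λ (Set.Ico (m i) (m (i + 1))),
    bitsEquiv a v ∈ bitsOn Λ (Set.Ico (m (i - 1)) (m (i + 2)))

section MapsCells

variable {a : Λ.Pauli ≃* Λ.Pauli} {m : ℤ → ℤ}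

/-- A site left of `m i` lies in a cell `i' < i`, whose image stays left of `m (i' + 2) ≤ m (i +
1)`. -/
theorem MapsCells.map_Iio (h : MapsCells a m) (hm : StrictMono m) (i : ℤ) :
    ∀ v ∈ bitsOn Λ (Set.Iio (m i)), bitsEquiv a v ∈ bitsOn Λ (Set.Iio (m (i + 1))) := by
  have key : bitsOn Λ (Set.Iio (m i)) ≤ (bitsOn Λ (Set.Iio (m (i + 1)))).comap
      (bitsEquiv a : Bits Λ →ₗ[ZMod 2] Bits Λ) := by
    refine bitsOn_le fun j hj => ?_
    obtain ⟨i', hi'⟩ := exists_mem_Ico_of_strictMono hm (Λ.site j)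
    have hlt : i' < i := hm.lt_iff_lt.1 (hi'.1.trans_lt hj)
    have hle : m (i' + 2) ≤ m (i + 1) := hm.monotone (by omega)
    have hsub : bitsOn Λ (Set.Ico (m (i' - 1)) (m (i' + 2))) ≤ bitsOn Λ (Set.Iio (m (i + 1))) :=
      bitsOn_mono fun k hk => hk.2.trans_le hle
    exact (single_mem_bitsOn hi').imp (fun h' => hsub (h i' _ h')) (fun h' => hsub (h i' _ h'))
  exact fun v hv => key hv

theorem MapsCells.map_Ici (h : MapsCells a m) (hm : StrictMono m) (i : ℤ) :
    ∀ v ∈ bitsOn Λ (Set.Ici (m (i + 1))), bitsEquiv a v ∈ bitsOn Λ (Set.Ici (m i)) := by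
  have key : bitsOn Λ (Set.Ici (m (i + 1))) ≤ (bitsOn Λ (Set.Ici (m i))).comap
      (bitsEquiv a : Bits Λ →ₗ[ZMod 2] Bits Λ) := by
    refine bitsOn_le fun j hj => ?_
    obtain ⟨i', hi'⟩ := exists_mem_Ico_of_strictMono hm (Λ.site j)
    have hlt : i + 1 < i' + 1 := hm.lt_iff_lt.1 (lt_of_le_of_lt hj hi'.2)
    have hle : m i ≤ m (i' - 1) := hm.monotone (by omega)
    have hsub : bitsOn Λ (Set.Ico (m (i' - 1)) (m (i' + 2))) ≤ bitsOn Λ (Set.Ici (m i)) :=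
      bitsOn_mono fun k hk => hle.trans hk.1
    exact (single_mem_bitsOn hi').imp (fun h' => hsub (h i' _ h')) (fun h' => hsub (h i' _ h'))
  exact fun v hv => key hv

/-- The bound for the inverse comes from the bound for `a` on the complementary half-line, by
passing to commutants. -/
theorem MapsCells.symm_map_Iio (h : MapsCells a m) (hm : StrictMono m) (i : ℤ) :
    ∀ v ∈ bitsOn Λ (Set.Iio (m i)), (bitsEquiv a).symm v ∈ bitsOn Λ (Set.Iio (m (i + 1))) := by
  have := bitsEquiv_symm_mapsTo_compl a (h.map_Ici hm i)
  rwa [Set.compl_Ici, Set.compl_Ici] at this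

theorem MapsCells.symm_map_Ici (h : MapsCells a m) (hm : StrictMono m) (i : ℤ) :
    ∀ v ∈ bitsOn Λ (Set.Ici (m (i + 1))), (bitsEquiv a).symm v ∈ bitsOn Λ (Set.Ici (m i)) := by
  have := bitsEquiv_symm_mapsTo_compl a (h.map_Iio hm i)
  rwa [Set.compl_Iio, Set.compl_Iio] at this

variable (a m) in
/-- The binary vectors of the Pauli operators in the right-moving algebra. -/
def rightMoving (i : ℤ) : Submodule (ZMod 2) (Bits Λ) :=
  (bitsOn Λ (Set.Ico (m i) (m (i + 2)))).map (bitsEquiv a : Bits Λ →ₗ[ZMod 2] Bits Λ) ⊓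
    bitsOn Λ (Set.Ico (m (i + 1)) (m (i + 3)))

theorem finite_rightMoving (i : ℤ) : Finite (rightMoving a m i) :=
  have := finite_bitsOn_Ico (Λ := Λ) (m (i + 1)) (m (i + 3))
  Finite.of_injective _ (Submodule.inclusion_injective
    (inf_le_right : rightMoving a m i ≤ bitsOn Λ (Set.Ico (m (i + 1)) (m (i + 3)))))

/-- With `X` the vectors left of `m (i + 1)`, both spaces split off `X`: `W = X ⊕ C` and `A W = X ⊕
T`. -/
theorem MapsCells.relDim_eq (h : MapsCells a m) (hm : StrictMono m) (i : ℤ) :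
    relDim ((bitsOn Λ (Set.Iio (m (i + 2)))).map (bitsEquiv a : Bits Λ →ₗ[ZMod 2] Bits Λ))
        (bitsOn Λ (Set.Iio (m (i + 2)))) =
      (Module.finrank (ZMod 2) (rightMoving a m i) : ℤ) -
        Module.finrank (ZMod 2) (bitsOn Λ (Set.Ico (m (i + 1)) (m (i + 2)))) := by
  have hlt : ∀ {j k : ℤ}, j ≤ k → m j ≤ m k := fun h => hm.monotone h
  set A := bitsEquiv a
  set X := bitsOn Λ (Set.Iio (m (i + 1)))
  set W := bitsOn Λ (Set.Iio (m (i + 2)))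
  set C := bitsOn Λ (Set.Ico (m (i + 1)) (m (i + 2)))
  set T := rightMoving a m i with hT
  have hXW : X ⊔ C = W := by
    rw [← bitsOn_union, Set.Iio_union_Ico_eq_Iio (hlt (by omega))]
  have hXA : X ≤ W.map (A : Bits Λ →ₗ[ZMod 2] Bits Λ) := fun v hv => by
    have := h.symm_map_Iio hm (i + 1) v hv
    rw [add_assoc] at this
    exact ⟨A.symm v, this, A.apply_symm_apply v⟩
  have hdC : Disjoint X C :=
    disjoint_bitsOn (Set.disjoint_left.2 fun k hk hk' => absurd hk'.1 (not_le.2 hk))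
  have hdT : Disjoint X T := Disjoint.mono_right inf_le_right
    (disjoint_bitsOn (Set.disjoint_left.2 fun k hk hk' => absurd hk'.1 (not_le.2 hk)))
  have hXT : X ⊔ T = W.map (A : Bits Λ →ₗ[ZMod 2] Bits Λ) := by
    refine le_antisymm (sup_le hXA (inf_le_left.trans (Submodule.map_mono
      (bitsOn_mono fun k hk => hk.2)))) fun u hu => ?_
    -- Split `u` at `m (i + 1)` as `x + y`. Since `X ≤ A W`, also `y = A w` with `w ∈ W`. Locality
    -- of the inverse puts `w` right of `m i`, and locality of `A` puts `y` left of `m (i + 3)`;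
    -- hence `y ∈ T`.
    have hu' : u ∈ X ⊔ bitsOn Λ (Set.Ici (m (i + 1))) := by
      rw [← bitsOn_union, Set.Iio_union_Ici]
      exact fun j hj => absurd trivial hj
    obtain ⟨x, hx, y, hy, rfl⟩ := Submodule.mem_sup.1 hu'
    obtain ⟨w, hw, rfl⟩ : y ∈ W.map (A : Bits Λ →ₗ[ZMod 2] Bits Λ) := by
      simpa using sub_mem hu (hXA hx)
    refine Submodule.add_mem_sup hx ⟨⟨w, ?_, rfl⟩, ?_⟩
    · have h1 := h.symm_map_Ici hm i _ hy
      have h2 : A.symm (A w) = w := A.symm_apply_apply w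
      have h3 : w ∈ bitsOn Λ (Set.Ici (m i)) := h2 ▸ h1
      have := Submodule.mem_inf.2 ⟨h3, hw⟩
      rwa [← bitsOn_inter] at this
    · have h1 := h.map_Iio hm (i + 2) w hw
      rw [add_assoc] at h1
      have := Submodule.mem_inf.2 ⟨hy, h1⟩
      rwa [← bitsOn_inter] at this
  have := finite_rightMoving (a := a) (m := m) i
  have := finite_bitsOn_Ico (Λ := Λ) (m (i + 1)) (m (i + 2))
  have : FiniteDimensional (ZMod 2) T := Module.Finite.of_finite
  have : FiniteDimensional (ZMod 2) C := Module.Finite.of_finite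
  rw [relDim_eq_sub hXA (hXW ▸ le_sup_left) (.of_sup_eq hXT) (.of_sup_eq hXW),
    relCodim_eq_finrank_of_isCompl hdT hXT, relCodim_eq_finrank_of_isCompl hdC hXW]

end MapsCells

/-! ### The `ℱ`-space of the full Pauli group -/

/-- A Pauli operator as an element of `𝒫 / 1`. -/
def pauliClass (p : Λ.Pauli) : (⊤ : Subgroup Λ.Pauli) ⧸ (⊥ : Subgroup (⊤ : Subgroup Λ.Pauli)) :=
  QuotientGroup.mk ⟨p, trivial⟩

variable (Λ) in
/-- The group `𝒫 / 1` is the Pauli group. -/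
def pauliClassEquiv :
    Λ.Pauli ≃* (⊤ : Subgroup Λ.Pauli) ⧸ (⊥ : Subgroup (⊤ : Subgroup Λ.Pauli)) :=
  (QuotientGroup.quotientBot.trans Subgroup.topEquiv).symm

theorem pauliClass_injective : Function.Injective (pauliClass (Λ := Λ)) :=
  (pauliClassEquiv Λ).injective

theorem pauliClass_mem_classesOn {R : Set ℤ} {p : Λ.Pauli} :
    pauliClass p ∈ classesOn (⊤ : Subgroup Λ.Pauli) ⊥ R ↔ bits p ∈ bitsOn Λ R := by
  rw [← supp_subset_iff]
  constructor
  · rintro ⟨P, hP, h⟩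
    have : (P : Λ.Pauli) = p := pauliClass_injective h
    rwa [← this]
  · exact fun h => ⟨⟨p, trivial⟩, h, rfl⟩

theorem exists_pauliClass_eq
    (g : (⊤ : Subgroup Λ.Pauli) ⧸ (⊥ : Subgroup (⊤ : Subgroup Λ.Pauli))) :
    ∃ p, pauliClass p = g := (pauliClassEquiv Λ).surjective g

/-- With trivial stabilizer a class has a single representative. For a class at `-∞` or `+∞` it
would have to avoid every site, so it is a scalar. -/
theorem bits_eq_zero_of_mem_classesAtInf {p : Λ.Pauli}
    (h : pauliClass p ∈ classesAtInf (⊤ : Subgroup Λ.Pauli) ⊥) : bits p = 0 := by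
  obtain ⟨x, hx, y, hy, hxy⟩ := Subgroup.mem_sup_of_normal_left.1 h
  obtain ⟨q, rfl⟩ := exists_pauliClass_eq x
  obtain ⟨q', rfl⟩ := exists_pauliClass_eq y
  have e : q * q' = p := pauliClass_injective hxy
  have h1 : bits q = 0 := by
    have : bits q ∈ bitsOn Λ ∅ := fun j _ =>
      pauliClass_mem_classesOn.1 (Subgroup.mem_iInf.1 hx (Λ.site j)) j (by simp)
    rwa [bitsOn_empty] at this
  have h2 : bits q' = 0 := by
    have : bits q' ∈ bitsOn Λ ∅ := fun j _ =>
      pauliClass_mem_classesOn.1 (Subgroup.mem_iInf.1 hy (Λ.site j)) j (by simp)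
    rwa [bitsOn_empty] at this
  rw [← e, bits_mul, h1, h2, add_zero]

theorem toFSpace_pauliClass_congr {p q : Λ.Pauli} (h : bits p = bits q) :
    toFSpace (pauliClass p) = toFSpace (pauliClass q) := by
  obtain ⟨c, rfl⟩ := eq_mul_scalar_of_bits_eq h
  have h0 : toFSpace (pauliClass (PauliOp.scalar c : Λ.Pauli)) = 0 :=
    (toFSpace_eq_zero_iff _).2 (mk_mem_classesAtInf _ rfl rfl)
  change toFSpace (pauliClass q * pauliClass (PauliOp.scalar c)) = _
  rw [toFSpace_mul, h0, add_zero]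

variable (Λ) in
/-- The linear map that sends a binary vector to the class of its Pauli operator in `ℱ`. -/
def bitsToFSpace : Bits Λ →ₗ[ZMod 2] FSpace (⊤ : Subgroup Λ.Pauli) ⊥ :=
  AddMonoidHom.toZModLinearMap 2
    { toFun := fun v => toFSpace (pauliClass (ofBits v))
      map_zero' := rfl
      map_add' := fun v w => by
        rw [← toFSpace_mul]
        exact toFSpace_pauliClass_congr (q := ofBits v * ofBits w) rfl }

theorem bitsToFSpace_bits (p : Λ.Pauli) :
    bitsToFSpace Λ (bits p) = toFSpace (pauliClass p) :=
  toFSpace_pauliClass_congr rfl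

variable (Λ) in
/-- The `ℱ`-space of the full Pauli group is the space of binary vectors. -/
def bitsFEquiv : Bits Λ ≃ₗ[ZMod 2] FSpace (⊤ : Subgroup Λ.Pauli) ⊥ :=
  LinearEquiv.ofBijective (bitsToFSpace Λ) ⟨by
    rw [← LinearMap.ker_eq_bot, LinearMap.ker_eq_bot']
    intro v hv
    exact bits_eq_zero_of_mem_classesAtInf ((toFSpace_eq_zero_iff _).1 hv), fun f => by
    obtain ⟨P, rfl⟩ := toFSpace_mk_surjective f
    exact ⟨bits (P : Λ.Pauli), bitsToFSpace_bits _⟩⟩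

theorem map_bitsFEquiv_bitsOn (k : ℤ) :
    (bitsOn Λ (Set.Iio k)).map (bitsFEquiv Λ : Bits Λ →ₗ[ZMod 2] _) =
      FBelow (⊤ : Subgroup Λ.Pauli) ⊥ k := by
  ext f
  rw [mem_FBelow]
  constructor
  · rintro ⟨v, hv, rfl⟩
    exact ⟨⟨ofBits v, trivial⟩, supp_subset_iff.2 hv, rfl⟩
  · rintro ⟨P, hP, rfl⟩
    exact ⟨bits (P : Λ.Pauli), supp_subset_iff.1 hP, bitsToFSpace_bits _⟩

/-- The position `k` of the cut stays free so that it can be placed at a cell boundary. -/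
theorem Ind_eq_relDim_bits {α : MQCA (⊤ : Subgroup Λ.Pauli) ⊥} {a : Λ.Pauli ≃* Λ.Pauli}
    (ha : ∀ p, (α : MulAut _) (pauliClass p) = pauliClass (a p)) (k : ℤ) :
    Ind α = (1 / 2 : ℚ) *
      relDim ((bitsOn Λ (Set.Iio k)).map (bitsEquiv a : Bits Λ →ₗ[ZMod 2] Bits Λ))
        (bitsOn Λ (Set.Iio k)) := by
  rw [Ind_eq_relDim α (isCut_FBelow k), ← map_bitsFEquiv_bitsOn, ← relDim_map_equiv (bitsFEquiv Λ),
    ← Submodule.map_comp, ← Submodule.map_comp]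
  congr 4
  refine LinearMap.ext fun v => ?_
  change inducedEquiv α (toFSpace (pauliClass (ofBits v))) =
    bitsToFSpace Λ (bitsEquiv a (bits (ofBits v)))
  rw [bitsEquiv_bits, bitsToFSpace_bits, inducedEquiv_toFSpace, ha]

/-! ### The GNVW index -/

/-- `Φ` acts on Pauli operators as `a`, up to phases. -/
def ExtendsUpToPhase (Φ : LocalAlg Λ ≃ₐ[ℂ] LocalAlg Λ) (a : Λ.Pauli ≃* Λ.Pauli) : Prop :=
  ∀ p, ∃ c, Φ (localPauli p) = localPauli (PauliOp.scalar c * a p)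

section GNVW

variable {Φ : LocalAlg Λ ≃ₐ[ℂ] LocalAlg Λ} {a : Λ.Pauli ≃* Λ.Pauli}

theorem ExtendsUpToPhase.map_basis (h : ExtendsUpToPhase Φ a) (v : Bits Λ) :
    ∃ c : ℂ, c ≠ 0 ∧ Φ (pauliBasis Λ v) = c • pauliBasis Λ (bitsEquiv a v) := by
  obtain ⟨c, hc⟩ := h (ofBits v)
  rw [← pauliBasis_apply, localPauli_eq_smul_basis, bits_mul, bits_scalar, zero_add,
    ← bitsEquiv_bits, bits_ofBits] at hc
  exact ⟨_, I_pow_val_ne_zero _, hc⟩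

theorem pauliBasis_mem_span {M : Set (Bits Λ)} {v : Bits Λ} :
    pauliBasis Λ v ∈ Submodule.span ℂ (pauliBasis Λ '' M) ↔ v ∈ M := by
  classical
  rw [Module.Basis.mem_span_image, Module.Basis.repr_self,
    Finsupp.support_single v (one_ne_zero (α := ℂ))]
  simp

/-- `Φ` permutes the Pauli basis by `bitsEquiv a`, up to nonzero factors. -/
theorem ExtendsUpToPhase.map_localOn (h : ExtendsUpToPhase Φ a) (R : Set ℤ) :
    Subalgebra.toSubmodule ((localOn Λ R).map (Φ : LocalAlg Λ →ₐ[ℂ] LocalAlg Λ)) =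
      Submodule.span ℂ (pauliBasis Λ '' ((bitsOn Λ R).map
        (bitsEquiv a : Bits Λ →ₗ[ZMod 2] Bits Λ) : Set (Bits Λ))) := by
  have e : Subalgebra.toSubmodule ((localOn Λ R).map (Φ : LocalAlg Λ →ₐ[ℂ] LocalAlg Λ)) =
      (Subalgebra.toSubmodule (localOn Λ R)).map
        (Φ : LocalAlg Λ →ₐ[ℂ] LocalAlg Λ).toLinearMap := rfl
  rw [e, localOn_eq_span, Submodule.map_span]
  apply le_antisymm <;> rw [Submodule.span_le]
  · rintro _ ⟨_, ⟨v, hv, rfl⟩, rfl⟩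
    obtain ⟨c, -, hcv⟩ := h.map_basis v
    change Φ (pauliBasis Λ v) ∈ _
    rw [hcv]
    exact Submodule.smul_mem _ _ (Submodule.subset_span ⟨_, ⟨v, hv, rfl⟩, rfl⟩)
  · rintro _ ⟨_, ⟨v, hv, rfl⟩, rfl⟩
    obtain ⟨c, hc, hcv⟩ := h.map_basis v
    refine (Submodule.smul_mem_iff _ hc).1 (Submodule.subset_span ⟨_, ⟨v, hv, rfl⟩, ?_⟩)
    exact hcv

theorem finrank_span_pauliBasis (M : Set (Bits Λ)) [Finite M] :
    Module.finrank ℂ (Submodule.span ℂ (pauliBasis Λ '' M)) = Nat.card M := by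
  have := Fintype.ofFinite M
  rw [Set.image_eq_range, Nat.card_eq_fintype_card]
  exact finrank_span_eq_card ((pauliBasis Λ).linearIndependent.comp _ Subtype.val_injective)

theorem finrank_localOn (a b : ℤ) : Module.finrank ℂ (localOn Λ (Set.Ico a b)) =
    2 ^ Module.finrank (ZMod 2) (bitsOn Λ (Set.Ico a b)) := by
  have := finite_bitsOn_Ico (Λ := Λ) a b
  have : Finite ((bitsOn Λ (Set.Ico a b) : Set (Bits Λ)) : Type) := this
  have h := finrank_span_pauliBasis (bitsOn Λ (Set.Ico a b) : Set (Bits Λ))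
  rw [← localOn_eq_span] at h
  refine h.trans ?_
  have h2 := Module.natCard_eq_pow_finrank (K := ZMod 2) (V := bitsOn Λ (Set.Ico a b))
  rwa [Nat.card_zmod] at h2

/-- Both algebras are spanned by parts of the same basis, so their intersection is spanned by the
common basis vectors, of which there are `2 ^ dim`. -/
theorem ExtendsUpToPhase.finrank_rightSupportAlg (h : ExtendsUpToPhase Φ a) (m : ℤ → ℤ) (i : ℤ) :
    Module.finrank ℂ (rightSupportAlg Φ m i) =
      2 ^ Module.finrank (ZMod 2) (rightMoving a m i) := by
  have e : Subalgebra.toSubmodule (rightSupportAlg Φ m i) =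
      Submodule.span ℂ (pauliBasis Λ '' (rightMoving a m i : Set (Bits Λ))) := by
    have : Subalgebra.toSubmodule (rightSupportAlg Φ m i) =
        Subalgebra.toSubmodule ((localOn Λ (Set.Ico (m i) (m (i + 2)))).map
          (Φ : LocalAlg Λ →ₐ[ℂ] LocalAlg Λ)) ⊓
        Subalgebra.toSubmodule (localOn Λ (Set.Ico (m (i + 1)) (m (i + 3)))) := rfl
    rw [this, h.map_localOn, localOn_eq_span]
    ext A
    simp only [Submodule.mem_inf, Module.Basis.mem_span_image, ← Set.subset_inter_iff]
    rfl
  have := finite_rightMoving (a := a) (m := m) i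
  have : Finite ((rightMoving a m i : Set (Bits Λ)) : Type) := this
  have h1 := finrank_span_pauliBasis (rightMoving a m i : Set (Bits Λ))
  rw [← e] at h1
  refine h1.trans ?_
  have h2 := Module.natCard_eq_pow_finrank (K := ZMod 2) (V := rightMoving a m i)
  rwa [Nat.card_zmod] at h2

theorem ExtendsUpToPhase.mapsCells (h : ExtendsUpToPhase Φ a) {m : ℤ → ℤ}
    (hm : IsNearestNeighbor Φ m) : MapsCells a m := by
  intro i v hv
  have h1 : Subalgebra.toSubmodule ((localOn Λ (Set.Ico (m i) (m (i + 1)))).map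
      (Φ : LocalAlg Λ →ₐ[ℂ] LocalAlg Λ)) ≤
      Subalgebra.toSubmodule (localOn Λ (Set.Ico (m (i - 1)) (m (i + 2)))) := hm.2 i
  rw [h.map_localOn, localOn_eq_span] at h1
  exact pauliBasis_mem_span.1 (h1 (pauliBasis_mem_span.2 ⟨v, hv, rfl⟩))

theorem IsUnitaryQCA.exists_isNearestNeighbor (h : IsUnitaryQCA Φ) :
    ∃ m, IsNearestNeighbor Φ m := by
  obtain ⟨r, hr⟩ := h.2
  have hpos : (0 : ℤ) < r + 1 := by positivity
  -- Cells of length `r + 1` exceed the range `r` and are nonempty even when `r = 0`.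
  refine ⟨fun i => i * (r + 1), fun i j hij => mul_lt_mul_of_pos_right hij hpos, fun i => ?_⟩
  refine (hr _).trans (Algebra.adjoin_mono (Set.image_mono fun p hp => ?_))
  refine Set.Subset.trans hp ?_
  rintro k ⟨j, hj, hkj⟩
  have h1 := abs_le.1 hkj
  obtain ⟨h2, h3⟩ := hj
  simp only [Set.mem_Ico] at *
  constructor <;> nlinarith [h1.1, h1.2]

theorem ExtendsUpToPhase.isGNVWIndex (h : ExtendsUpToPhase Φ a) (hΦ : IsUnitaryQCA Φ)
    {α : MQCA (⊤ : Subgroup Λ.Pauli) ⊥}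
    (ha : ∀ p, (α : MulAut _) (pauliClass p) = pauliClass (a p)) :
    IsGNVWIndex Φ ((2 : ℝ) ^ ((Ind α : ℚ) : ℝ)) := by
  refine ⟨hΦ.exists_isNearestNeighbor, fun m hm i => ?_⟩
  -- The cut is placed at `m (i + 2)`, the right end of the cell in the denominator, where
  -- `MapsCells.relDim_eq` applies.
  rw [h.finrank_rightSupportAlg, finrank_localOn, Ind_eq_relDim_bits ha (m (i + 2)),
    (h.mapsCells hm).relDim_eq hm.1 i, Real.sqrt_eq_rpow]
  push_cast
  rw [← Real.rpow_natCast, ← Real.rpow_natCast, ← Real.rpow_sub two_pos,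
    ← Real.rpow_mul two_pos.le]
  congr 1
  ring

end GNVW

/-! ### Automorphisms of the full Pauli group as MQCA -/

section FullPauliGroup

variable (α : MulAut ((⊤ : Subgroup Λ.Pauli) ⧸ (⊥ : Subgroup (⊤ : Subgroup Λ.Pauli))))

/-- The automorphism of the Pauli group that corresponds to an automorphism of `𝒫 / 1`. -/
def pauliAut : Λ.Pauli ≃* Λ.Pauli :=
  (pauliClassEquiv Λ).trans (MulEquiv.trans α (pauliClassEquiv Λ).symm)

theorem pauliClass_pauliAut (p : Λ.Pauli) : pauliClass (pauliAut α p) = α (pauliClass p) :=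
  (pauliClassEquiv Λ).apply_symm_apply _

theorem map_mk_eq_iff (P P' : (⊤ : Subgroup Λ.Pauli)) :
    α (QuotientGroup.mk P) = QuotientGroup.mk P' ↔ pauliAut α P = P' := by
  rw [← pauliClass_injective.eq_iff, pauliClass_pauliAut]
  rfl

/-- Classes modulo the trivial group have one representative, so locality of classes is locality of
the operators themselves. -/
theorem localityPreserving_iff : LocalityPreserving (MulEquiv.toMonoidHom α) ↔
    ∃ r, ∀ p, Λ.supp (pauliAut α p) ⊆ nbhd r (Λ.supp p) := by
  refine exists_congr fun r => ⟨fun h p => ?_, fun h P => ?_⟩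
  · obtain ⟨Q, hQ, hs⟩ := h ⟨p, trivial⟩
    rwa [(map_mk_eq_iff α ⟨p, trivial⟩ Q).1 hQ]
  · exact ⟨⟨pauliAut α P, trivial⟩, (map_mk_eq_iff α P _).2 rfl, h P⟩

theorem implementsUpToPhase_iff (Φ : LocalAlg Λ ≃ₐ[ℂ] LocalAlg Λ) :
    ImplementsUpToPhase Φ α ↔ ExtendsUpToPhase Φ (pauliAut α) := by
  constructor
  · exact fun h p => h ⟨p, trivial⟩ ⟨pauliAut α p, trivial⟩ ((map_mk_eq_iff α _ _).2 rfl)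
  · intro h P P' hPP'
    rw [← (map_mk_eq_iff α P P').1 hPP']
    exact h P

theorem implements_iff (Φ : LocalAlg Λ ≃ₐ[ℂ] LocalAlg Λ) :
    Implements Φ α ↔ ∀ p, Φ (localPauli p) = localPauli (pauliAut α p) := by
  constructor
  · exact fun h p => h ⟨p, trivial⟩ ⟨pauliAut α p, trivial⟩ ((map_mk_eq_iff α _ _).2 rfl)
  · intro h P P' hPP'
    rw [← (map_mk_eq_iff α P P').1 hPP']
    exact h P

theorem fixesScalars_iff :
    FixesScalars α ↔ ∀ c, pauliAut α (PauliOp.scalar c) = PauliOp.scalar c :=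
  forall_congr' fun _ => map_mk_eq_iff α _ _

variable {α}

theorem mem_MQCA_of_localityPreserving (h : LocalityPreserving (MulEquiv.toMonoidHom α)) :
    α ∈ MQCA (⊤ : Subgroup Λ.Pauli) ⊥ := by
  refine ⟨h, ?_⟩
  obtain ⟨r, hr⟩ := (localityPreserving_iff α).1 h
  exact (localityPreserving_iff α.symm).2 ⟨r, supp_symm_subset (pauliAut α) hr⟩

theorem existsUnique_implements (h : LocalityPreserving (MulEquiv.toMonoidHom α))
    (hα : FixesScalars α) : ∃! Φ, IsUnitaryQCA Φ ∧ Implements Φ α := by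
  obtain ⟨r, hr⟩ := (localityPreserving_iff α).1 h
  have ha := (fixesScalars_iff α).1 hα
  refine ⟨extendEquiv ha, ⟨isUnitaryQCA_extendEquiv ha hr,
    (implements_iff α _).2 (extendEquiv_localPauli ha)⟩, fun Φ hΦ => ?_⟩
  have hΦ' := (implements_iff α _).1 hΦ.2
  have e : (Φ : LocalAlg Λ →ₐ[ℂ] LocalAlg Λ) = extendEquiv ha :=
    algHom_ext_localPauli fun p => (hΦ' p).trans (extendEquiv_localPauli ha p).symm
  exact AlgEquiv.ext fun A => DFunLike.congr_fun e A

end FullPauliGroup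

end PauliIndex

end

theorem mainTheorem7 :
    -- the index is well defined: `φ` is Fredholm and the choices of `a`, `b`, `ℱ₀`, `ν` do not matter
    (∀ (Λ : QubitChain) (L : Subgroup Λ.Pauli) (S : Subgroup L) [S.Normal] (α : MQCA L S)
      (a b : ℤ) (F₀ : Submodule (ZMod 2) (FSpace L S)) (ν : FSpace L S →ₗ[ZMod 2] FSpace L S)
      (hν : LinearMap.IsProj F₀ ν), a ≤ b → FBelow L S a ≤ F₀ → F₀ ≤ FBelow L S b →
        FredholmMap (cutMap α F₀ ν hν) ∧
        Ind α = (1 / 2 : ℚ) * fredholmIndex (cutMap α F₀ ν hν)) ∧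
    -- additivity under tensor products
    (∀ (Λ₁ Λ₂ : QubitChain) (L₁ : Subgroup Λ₁.Pauli) (S₁ : Subgroup L₁) [S₁.Normal]
      (L₂ : Subgroup Λ₂.Pauli) (S₂ : Subgroup L₂) [S₂.Normal] (α : MQCA L₁ S₁) (β : MQCA L₂ S₂),
        ((∃! γ, IsTensor α β γ) ↔ AgreeOnScalars α β) ∧
        ∀ γ, IsTensor α β γ → Ind γ = Ind α + Ind β) ∧
    -- additivity under composition
    (∀ (Λ : QubitChain) (L : Subgroup Λ.Pauli) (S : Subgroup L) [S.Normal],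
        (∀ α β : MQCA L S, Ind (α * β) = Ind α + Ind β) ∧
        Ind (1 : MQCA L S) = 0 ∧
        ∀ α : MQCA L S, Ind α⁻¹ = -Ind α) ∧
    -- invariance under conjugation by a locality-preserving isomorphism
    (∀ (Λ Λ' : QubitChain) (L : Subgroup Λ.Pauli) (S : Subgroup L) [S.Normal]
      (L' : Subgroup Λ'.Pauli) (S' : Subgroup L') [S'.Normal] (U : L ⧸ S ≃* L' ⧸ S'),
        LocalityPreservingIso U → ∀ α : MQCA L S,
          ∃ h : U.symm.trans ((α : MulAut (L ⧸ S)).trans U) ∈ MQCA L' S',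
            Ind (⟨_, h⟩ : MQCA L' S') = Ind α) ∧
    -- on the full Pauli group the index is the logarithm of the GNVW index
    (∀ (Λ : QubitChain)
      (α : MulAut ((⊤ : Subgroup Λ.Pauli) ⧸ (⊥ : Subgroup (⊤ : Subgroup Λ.Pauli)))),
        LocalityPreserving α.toMonoidHom →
          ∃ h : α ∈ MQCA (⊤ : Subgroup Λ.Pauli) ⊥,
            (∃ Φ, IsUnitaryQCA Φ ∧ ImplementsUpToPhase Φ α) ∧
            (FixesScalars α → ∃! Φ, IsUnitaryQCA Φ ∧ Implements Φ α) ∧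
            ∀ Φ, IsUnitaryQCA Φ → ImplementsUpToPhase Φ α →
              IsGNVWIndex Φ ((2 : ℝ) ^ ((Ind (⟨α, h⟩ : MQCA (⊤ : Subgroup Λ.Pauli) ⊥) : ℚ) : ℝ))) := by
  refine ⟨?_, ?_, ?_, ?_, ?_⟩
  · intro Λ L S _ α a b F₀ ν hν _ ha hb
    exact Ind_well_defined α hν ha hb
  · intro Λ₁ Λ₂ L₁ S₁ _ L₂ S₂ _ α β
    exact ⟨existsUnique_isTensor_iff α β, fun _ hγ => hγ.Ind_eq⟩
  · intro Λ L S _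
    exact ⟨Ind_mul, Ind_one, Ind_inv⟩
  · intro Λ Λ' L S _ L' S' _ U hU α
    exact ⟨hU.conj_mem α, Ind_conj hU α⟩
  · intro Λ α hα
    obtain ⟨r, hr⟩ := (localityPreserving_iff α).1 hα
    refine ⟨mem_MQCA_of_localityPreserving hα, ?_, existsUnique_implements hα, fun Φ hΦ hI => ?_⟩
    · obtain ⟨Φ, hΦ, hI⟩ := exists_isUnitaryQCA_up_to_phase (pauliAut α) hr
      exact ⟨Φ, hΦ, (implementsUpToPhase_iff α Φ).2 hI⟩
    · exact ((implementsUpToPhase_iff α Φ).1 hI).isGNVWIndex hΦ fun p =>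
        (pauliClass_pauliAut α p).symm
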